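/- **Setting.** All distributions have finite support. In the probabilistic calculus of cyber-physical systems (CPSs), *processes* are given by $$P,Q ::= \mathsf{nil} \mid \mathsf{tick}.C \mid P\parallel Q \mid \lfloor \overline{c}\langle v\rangle.C\rfloor D \mid \lfloor c(x).C\rfloor D \mid \mathsf{read}\,x(s).C \mid \mathsf{write}\,a\langle v\rangle.C \mid \text{if } b \text{ then } P \text{ else } Q \mid P\backslash c \mid X \mid \mathsf{fix}X.P ,$$ where $C,D$ are finite probabilistic choices $\bigoplus_i p_i{:}P_i$, read as distributions $[\![C]\!]=\sum_i p_i\delta_{P_i}$, and a conditional is identified with the selected branch. Their labelled transitions to distributions are: $\lfloor \overline c\langle v\rangle.C\rfloor D\xrightarrow{\overline c v}[\![C]\!]$; $\lfloor c(x).C\rfloor D\xrightarrow{cv}[\![C\{v/x\}]\!]$; both tick to $[\![D]\!]$; $\mathsf{write}\,a\langle v\rangle.C\xrightarrow{a!v}[\![C]\!]$; $\mathsf{read}\,x(s).C$ reads the value $v$ of $s$ and becomes $[\![C\{v/x\}]\!]$; $\mathsf{tick}.C\xrightarrow{\mathsf{tick}}[\![C]\!]$; $\mathsf{nil}\xrightarrow{\mathsf{tick}}\delta_{\mathsf{nil}}$;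 parallel components interleave untimed actions, synchronise on $\overline c v$ and $cv$ (giving $\tau$), and tick together if no $\tau$ is possible; $P\backslash c$ forbids communication on $c$; $\mathsf{fix}X.P$ moves as $P\{\mathsf{fix}X.P/X\}$. A *CPS* is either the system $\mathsf{Dead}$, which has no transitions, or a triple $E;S\bowtie P$ of an environment $E=(\mathit{evol},\mathit{meas},\mathit{inv})$, a physical state $S=(\xi_x,\xi_s,\xi_a)$ of real-valued functions on the state variables, sensors and actuators, and a process $P$. If $\xi_x\in\mathit{inv}$, its $\tau$- and communication transitions are those of $P$, with $S$ unchanged; a read of a sensor $s$ is a $\tau$-transition and returns $\xi_s(s)$; a write $a!v$ is a $\tau$-transition setting $\xi_a(a)=v$; and if $P$ can tick and no $\tau$-transition of the system is possible, the system ticks, $\xi'_x$ being drawn from $\mathit{evol}(\xi_x,\xi_a)$ and then $\xi'_s$ from $\mathit{meas}(\xi'_x)$. If $\xi_x\notin\mathit{inv}$, the only transition is $\xrightarrow{\tau}\delta_{\mathsf{Dead}}$. **Weak transitions and distance.** Let $M\xrightarrow{\hat\alpha}\gamma$ mean $M\xrightarrow{\alpha}\gamma$, or $\alpha=\tau$ and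 $\gamma=\delta_M$. For sub-distributions, $\gamma\xrightarrow{\hat\alpha}\gamma'$ means that $\gamma=\sum_{i\in I}p_i\delta_{M_i}$ with $p_i>0$, and for some non-empty $J\subseteq I$, $M_j\xrightarrow{\hat\alpha}\gamma_j$ for $j\in J$, $M_i\not\xrightarrow{\hat\alpha}$ for $i\notin J$, and $\gamma'=\sum_{j\in J}p_j\gamma_j$. Let $\stackrel{\hat\tau}{\Rightarrow}$ be the reflexive transitive closure of $\xrightarrow{\hat\tau}$, let $\stackrel{\hat\alpha}{\Rightarrow}$ be $\stackrel{\hat\tau}{\Rightarrow}\xrightarrow{\hat\alpha}\stackrel{\hat\tau}{\Rightarrow}$ for $\alpha\ne\tau$, and let $M\stackrel{\hat\alpha}{\Rightarrow}\gamma$ mean $\delta_M\stackrel{\hat\alpha}{\Rightarrow}\gamma$. For $d$ from pairs of CPSs to $[0,1]$, $\mathbf K(d)(\gamma,\gamma')$ is the minimum of $\sum\omega(M,N)\,d(M,N)$ over the couplings $\omega$ of $(\gamma,\gamma')$. Writing $|\gamma|$ for the total mass of $\gamma$ and $\gamma^\bullet=\gamma+(1-|\gamma|)\delta_{\mathsf{Dead}}$,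 set $$\mathbf B(d)(M,N)=\sup_{\alpha:\,M\xrightarrow{\alpha}\ \vee\ N\xrightarrow{\alpha}}\max\Big\{\max_{M\xrightarrow{\alpha}\gamma_1}\ \min_{N\stackrel{\hat\alpha}{\Rightarrow}\gamma_2}\mathbf K(d)(\gamma_1,\gamma_2^\bullet),\ \max_{N\xrightarrow{\alpha}\gamma_2}\ \min_{M\stackrel{\hat\alpha}{\Rightarrow}\gamma_1}\mathbf K(d)(\gamma_1^\bullet,\gamma_2)\Big\},$$ with $\max\emptyset=0$ and $\min\emptyset=1$. The $n$-weak bisimilarity metric is $\mathbf d^n=\mathbf B^n(\mathbf 0)$, where $\mathbf 0$ is the zero function. **The engines.** For $g\ge1$ and an interval $J$ with left end $v$ let $J_g=\{k\in J: k=v+h\,10^{-g},\ h\in\mathbb N\}$. The engine $\mathit{Eng}_g$ has one state variable $\mathit{temp}$, one sensor $s_t$ and one actuator $\mathit{cool}$ (which is on if its value is negative and off otherwise), with initial temperature $0$, sensed temperature $0$ and cooling off. In each time slot $\mathit{temp}$ changes by a value uniform in $[0.6,1.4]_g$ if the cooling is off and in $[-1.4,-0.6]_g$ if it is on; then $s_t$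 is set to $\mathit{temp}$ plus a value uniform in $[-0.1,0.1]_g$; the invariant is $0\le\mathit{temp}\le30$. Its process is $$\mathit{Ctrl}=\mathsf{fix}X.\ \mathsf{read}\,x(s_t).\ \text{if } x>10 \text{ then } \mathit{Cooling} \text{ else } \mathsf{tick}.X ,$$ $$\mathit{Cooling}=\mathsf{write}\,\mathit{cool}\langle\mathrm{on}\rangle.\ \mathsf{fix}Y.\ \mathsf{tick}^5.\ \mathsf{read}\,x(s_t).\ \text{if } x>10 \text{ then } \overline{\mathit{warning}}\langle \mathrm{ID}\rangle.Y \text{ else } \mathsf{write}\,\mathit{cool}\langle\mathrm{off}\rangle.\mathsf{tick}.X ,$$ where $\overline{c}\langle v\rangle.P$ abbreviates $\mathsf{fix}Z.\lfloor\overline{c}\langle v\rangle.P\rfloor Z$. The variant $\widehat{\mathit{Eng}}_g$ is the same except that the change under active cooling is uniform in $[-1.1,-0.3]_g$ (cooling power reduced by 30%). **Proposition.** Let $g\ge 1$ and $n\ge 0$ be integers, and let $$p_g=\frac{|[0.3,0.4)_g|}{|[0.3,1.1]_g|},\qquad q_g=\frac{|(1.3,1.4]_g|}{|[0.6,1.4]_g|}.$$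 Then $$\mathbf d^n(\mathit{Eng}_g,\widehat{\mathit{Eng}}_g)\ \le\ 1-\bigl(1-q_g\,p_g^5\bigr)^n ,$$ and $p_g=q_g=\dfrac{1}{8+10^{1-g}}$. -/

import Mathlib

open scoped NNReal
open Convexity

noncomputable section

namespace ProbCPS

/-! ### Finite-support distributions -/

/-- Finite-support probability distributions over `α`. -/
abbrev FDist (α : Type) : Type := StdSimplex ℝ≥0 α

/-- Finite-support weightings over `α`; those of positive total mass at most `1` are the
sub-distributions. -/
abbrev FSub (α : Type) : Type := α →₀ ℝ≥0

/-- The total mass `|γ|`. -/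
def FSub.mass {α : Type} (γ : FSub α) : ℝ≥0 := γ.sum fun _ r => r

/-- The Dirac distribution at `a`. -/
def dirac {α : Type} (a : α) : FDist α := StdSimplex.single a

/-- The convex combination `∑ a, μ a • f a`. -/
def FDist.bind {α β : Type} (μ : FDist α) (f : α → FDist β) : FDist β := iConvexComb μ f

/-- The uniform distribution on a finite non-empty set. -/
def uniform {α : Type} (s : Finset α) (hs : s.Nonempty) : FDist α where
  weights := ∑ a ∈ s, Finsupp.single a (1 / (s.card : ℝ≥0))
  nonneg := zero_le
  total := by
    have h : (s.card : ℝ≥0) ≠ 0 := by exact_mod_cast hs.card_pos.ne'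
    rw [← Finsupp.sum_finsetSum_index (fun _ => rfl) (fun _ _ _ => rfl)]
    simp [h]

/-- The expectation of a `[0,1]`-valued function. -/
def FDist.expect {α : Type} (μ : FDist α) (f : α → unitInterval) : unitInterval :=
  ⟨μ.weights.sum fun a r => (r : ℝ) * (f a : ℝ), by
    constructor
    · exact Finset.sum_nonneg fun a _ => mul_nonneg (NNReal.coe_nonneg _) (f a).2.1
    · have h : ((μ.weights.sum fun _ r => r : ℝ≥0) : ℝ) = 1 := by rw [μ.total]; rfl
      rw [← h, Finsupp.sum, Finsupp.sum, NNReal.coe_sum]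
      exact Finset.sum_le_sum fun a _ =>
        mul_le_of_le_one_right (NNReal.coe_nonneg _) (f a).2.2⟩

/-! ### Logical components

`Ch`, `V`, `A`, `S` are the sets of channels, of transmitted values, of actuators and of sensors.
Value binders are represented by functions (the term substituted for `x` by `v` is `k v`), so that
a conditional whose guard depends on bound variables is an ordinary `if … then … else …`.
Process variables are de Bruijn indices, so that terms are identified up to renaming of them. -/

mutual
/-- Processes. -/
inductive Proc (Ch V A S : Type) : Type where
  /-- the terminated process -/
  | nil : Proc Ch V A S
  /-- sleeping for one time unit -/
  | tick (C : Choice Ch V A S) : Proc Ch V A S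
  | par (P Q : Proc Ch V A S) : Proc Ch V A S
  /-- transmission of `v` on `c`, continuing as `C`, with timeout `D` -/
  | out (c : Ch) (v : V) (C D : Choice Ch V A S) : Proc Ch V A S
  /-- reception on `c`, continuing as `k v` on receiving `v`, with timeout `D` -/
  | inp (c : Ch) (k : V → Choice Ch V A S) (D : Choice Ch V A S) : Proc Ch V A S
  /-- reading the sensor `s`, continuing as `k v` if the value is `v` -/
  | read (s : S) (k : ℝ → Choice Ch V A S) : Proc Ch V A S
  /-- writing `v` on the actuator `a` -/
  | write (v : ℝ) (a : A) (C : Choice Ch V A S) : Proc Ch V A S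
  /-- channel restriction -/
  | res (P : Proc Ch V A S) (c : Ch) : Proc Ch V A S
  | var (i : ℕ) : Proc Ch V A S
  /-- recursion, binding the variable `0` of `P` -/
  | fix (P : Proc Ch V A S) : Proc Ch V A S
/-- Probabilistic choices `⊕ i, w i : P i` over a finite non-empty index set, with positive weights
of sum `1`. -/
inductive Choice (Ch V A S : Type) : Type where
  | mk (n : ℕ) (w : FDist (Fin n)) (pos : ∀ i, 0 < w.weights i) (P : Fin n → Proc Ch V A S) :
      Choice Ch V A S
end

variable {Ch V A S X : Type}

/-- The one-branch probabilistic choice `1 : P`. -/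
def Choice.one (P : Proc Ch V A S) : Choice Ch V A S :=
  .mk 1 (dirac 0) (fun i => by rw [Subsingleton.elim i 0]; simp [dirac]) fun _ => P

/-- The distribution over processes denoted by a probabilistic choice. -/
def Choice.sem : Choice Ch V A S → FDist (Proc Ch V A S)
  | .mk _ w _ P => w.map P

mutual
/-- Substitution of `Q` for the process variable `i`. It is used for closed `Q` only, so `Q` needs
no renumbering under binders. -/
def Proc.subst (Q : Proc Ch V A S) : ℕ → Proc Ch V A S → Proc Ch V A S
  | _, .nil => .nil
  | i, .tick C => .tick (Choice.subst Q i C)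
  | i, .par P P' => .par (Proc.subst Q i P) (Proc.subst Q i P')
  | i, .out c v C D => .out c v (Choice.subst Q i C) (Choice.subst Q i D)
  | i, .inp c k D => .inp c (fun v => Choice.subst Q i (k v)) (Choice.subst Q i D)
  | i, .read s k => .read s (fun v => Choice.subst Q i (k v))
  | i, .write v a C => .write v a (Choice.subst Q i C)
  | i, .res P c => .res (Proc.subst Q i P) c
  | i, .var j => if j = i then Q else if i < j then .var (j - 1) else .var j
  | i, .fix P => .fix (Proc.subst Q (i + 1) P)
def Choice.subst (Q : Proc Ch V A S) : ℕ → Choice Ch V A S → Choice Ch V A S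
  | i, .mk n w pos P => .mk n w pos fun j => Proc.subst Q i (P j)
end

/-- The unfolding of `fix P`. -/
def Proc.unfold (P : Proc Ch V A S) : Proc Ch V A S := Proc.subst (.fix P) 0 P

/-- The untimed labels of processes. -/
inductive Label (Ch V A S : Type) : Type where
  | tau : Label Ch V A S
  | out (c : Ch) (v : V) : Label Ch V A S
  | inp (c : Ch) (v : V) : Label Ch V A S
  /-- writing `v` on the actuator `a` -/
  | write (a : A) (v : ℝ) : Label Ch V A S
  /-- reading the value `v` at the sensor `s` -/
  | read (s : S) (v : ℝ) : Label Ch V A S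

/-- The distribution `π₁ ∥ π₂`. -/
def parDist (π₁ π₂ : FDist (Proc Ch V A S)) : FDist (Proc Ch V A S) :=
  FDist.bind π₁ fun P => π₂.map fun Q => Proc.par P Q

/-- The distribution `π \ c`. -/
def resDist (π : FDist (Proc Ch V A S)) (c : Ch) : FDist (Proc Ch V A S) :=
  π.map fun P => Proc.res P c

/-- The untimed transitions of processes. They do not depend on the timed ones, so they are defined
first; the timed transitions have a negative premise on them. -/
inductive Proc.Step : Proc Ch V A S → Label Ch V A S → FDist (Proc Ch V A S) → Prop where
  | outp (c : Ch) (v : V) (C D : Choice Ch V A S) : Step (.out c v C D) (.out c v) C.sem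
  | inpp (c : Ch) (v : V) (k : V → Choice Ch V A S) (D : Choice Ch V A S) :
      Step (.inp c k D) (.inp c v) (k v).sem
  | write (v : ℝ) (a : A) (C : Choice Ch V A S) : Step (.write v a C) (.write a v) C.sem
  | read (s : S) (v : ℝ) (k : ℝ → Choice Ch V A S) : Step (.read s k) (.read s v) (k v).sem
  | com {P₁ P₂ : Proc Ch V A S} {c : Ch} {v : V} {π₁ π₂ : FDist (Proc Ch V A S)} :
      Step P₁ (.out c v) π₁ → Step P₂ (.inp c v) π₂ → Step (.par P₁ P₂) .tau (parDist π₁ π₂)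
  | com' {P₁ P₂ : Proc Ch V A S} {c : Ch} {v : V} {π₁ π₂ : FDist (Proc Ch V A S)} :
      Step P₁ (.inp c v) π₁ → Step P₂ (.out c v) π₂ → Step (.par P₁ P₂) .tau (parDist π₁ π₂)
  | par {P : Proc Ch V A S} {l : Label Ch V A S} {π : FDist (Proc Ch V A S)}
      (Q : Proc Ch V A S) : Step P l π → Step (.par P Q) l (parDist π (dirac Q))
  | par' {P : Proc Ch V A S} {l : Label Ch V A S} {π : FDist (Proc Ch V A S)}
      (Q : Proc Ch V A S) : Step P l π → Step (.par Q P) l (parDist (dirac Q) π)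
  | res {P : Proc Ch V A S} {l : Label Ch V A S} {π : FDist (Proc Ch V A S)} {c : Ch} :
      Step P l π → (∀ v, l ≠ .inp c v) → (∀ v, l ≠ .out c v) → Step (.res P c) l (resDist π c)
  | fix {P : Proc Ch V A S} {l : Label Ch V A S} {π : FDist (Proc Ch V A S)} :
      Step P.unfold l π → Step (.fix P) l π

/-- The timed transitions of processes. -/
inductive Proc.Tick : Proc Ch V A S → FDist (Proc Ch V A S) → Prop where
  | nil : Tick .nil (dirac .nil)
  | delay (C : Choice Ch V A S) : Tick (.tick C) C.sem
  | timeoutOut (c : Ch) (v : V) (C D : Choice Ch V A S) : Tick (.out c v C D) D.sem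
  | timeoutInp (c : Ch) (k : V → Choice Ch V A S) (D : Choice Ch V A S) :
      Tick (.inp c k D) D.sem
  | par {P₁ P₂ : Proc Ch V A S} {π₁ π₂ : FDist (Proc Ch V A S)} :
      Tick P₁ π₁ → Tick P₂ π₂ → (¬ ∃ π, Proc.Step (.par P₁ P₂) .tau π) →
      Tick (.par P₁ P₂) (parDist π₁ π₂)
  | res {P : Proc Ch V A S} {π : FDist (Proc Ch V A S)} {c : Ch} :
      Tick P π → Tick (.res P c) (resDist π c)
  | fix {P : Proc Ch V A S} {π : FDist (Proc Ch V A S)} :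
      Tick P.unfold π → Tick (.fix P) π

/-! ### Cyber-physical systems -/

/-- Physical states: the state, sensor and actuator functions. -/
structure PState (X A S : Type) : Type where
  x : X → ℝ
  s : S → ℝ
  a : A → ℝ

/-- Physical environments: evolution map, measurement map and invariant set. -/
structure Env (X A S : Type) : Type where
  evol : (X → ℝ) → (A → ℝ) → FDist (X → ℝ)
  meas : (X → ℝ) → FDist (S → ℝ)
  inv : Set (X → ℝ)

/-- The distribution over the physical states of the next time slot. -/
def Env.next (E : Env X A S) (σ : PState X A S) : FDist (PState X A S) :=
  FDist.bind (E.evol σ.x σ.a) fun x' => (E.meas x').map fun s' => ⟨x', s', σ.a⟩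

/-- Cyber-physical systems with state variables `X`, sensors `S` and actuators `A`, together with
the deadlocked system. Systems whose process is open or has unguarded recursion are not excluded
from the type; no system with a closed, time-guarded process ever reaches one. -/
inductive CPS (Ch V X A S : Type) : Type where
  | dead : CPS Ch V X A S
  | sys (E : Env X A S) (σ : PState X A S) (P : Proc Ch V A S) : CPS Ch V X A S

/-- The actions of systems. -/
inductive Act (Ch V : Type) : Type where
  | tau : Act Ch V
  | out (c : Ch) (v : V) : Act Ch V
  | inp (c : Ch) (v : V) : Act Ch V
  | tick : Act Ch V

/-- The distribution over systems with environment `E` induced by a distribution over physical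
states and one over processes. -/
def sysDist (E : Env X A S) (ρ : FDist (PState X A S)) (π : FDist (Proc Ch V A S)) :
    FDist (CPS Ch V X A S) :=
  FDist.bind ρ fun σ => π.map fun P => CPS.sys E σ P

open Classical in
/-- The physical state `σ` with the actuator `a` set to `v`. -/
def PState.setAct (σ : PState X A S) (a : A) (v : ℝ) : PState X A S :=
  { σ with a := Function.update σ.a a v }

/-- The untimed transitions of systems. -/
inductive CPS.UStep : CPS Ch V X A S → Act Ch V → FDist (CPS Ch V X A S) → Prop where
  | out {E : Env X A S} {σ : PState X A S} {P : Proc Ch V A S} {π : FDist (Proc Ch V A S)}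
      {c : Ch} {v : V} : P.Step (.out c v) π → σ.x ∈ E.inv →
      UStep (.sys E σ P) (.out c v) (sysDist E (dirac σ) π)
  | inp {E : Env X A S} {σ : PState X A S} {P : Proc Ch V A S} {π : FDist (Proc Ch V A S)}
      {c : Ch} {v : V} : P.Step (.inp c v) π → σ.x ∈ E.inv →
      UStep (.sys E σ P) (.inp c v) (sysDist E (dirac σ) π)
  | tau {E : Env X A S} {σ : PState X A S} {P : Proc Ch V A S} {π : FDist (Proc Ch V A S)} :
      P.Step .tau π → σ.x ∈ E.inv → UStep (.sys E σ P) .tau (sysDist E (dirac σ) π)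
  | sensRead {E : Env X A S} {σ : PState X A S} {P : Proc Ch V A S} {π : FDist (Proc Ch V A S)}
      {s : S} : P.Step (.read s (σ.s s)) π → σ.x ∈ E.inv →
      UStep (.sys E σ P) .tau (sysDist E (dirac σ) π)
  | actWrite {E : Env X A S} {σ : PState X A S} {P : Proc Ch V A S} {π : FDist (Proc Ch V A S)}
      {a : A} {v : ℝ} : P.Step (.write a v) π → σ.x ∈ E.inv →
      UStep (.sys E σ P) .tau (sysDist E (dirac (σ.setAct a v)) π)
  | deadlock {E : Env X A S} {σ : PState X A S} (P : Proc Ch V A S) : σ.x ∉ E.inv →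
      UStep (.sys E σ P) .tau (dirac .dead)

/-- The transitions of systems. -/
inductive CPS.Step : CPS Ch V X A S → Act Ch V → FDist (CPS Ch V X A S) → Prop where
  | untimed {M : CPS Ch V X A S} {α : Act Ch V} {γ : FDist (CPS Ch V X A S)} :
      M.UStep α γ → Step M α γ
  | time {E : Env X A S} {σ : PState X A S} {P : Proc Ch V A S} {π : FDist (Proc Ch V A S)} :
      P.Tick π → (¬ ∃ γ, CPS.UStep (.sys E σ P) .tau γ) → σ.x ∈ E.inv →
      Step (.sys E σ P) .tick (sysDist E (E.next σ) π)

/-! ### Weak transitions -/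

/-- `M —α̂→ γ`: a transition of `M`, or staying at `M` if `α` is `τ`. -/
def CPS.HatStep (M : CPS Ch V X A S) (α : Act Ch V) (γ : FDist (CPS Ch V X A S)) : Prop :=
  M.Step α γ ∨ (α = .tau ∧ γ = dirac M)

/-- `γ —α̂→ γ'` for sub-distributions: in some decomposition `γ = ∑ i, p i • δ (M i)`, exactly the
`M j` with `j ∈ J ≠ ∅` can move, and `γ' = ∑ j ∈ J, p j • η j` for moves `M j —α̂→ η j`. -/
def SubStep (α : Act Ch V) (γ γ' : FSub (CPS Ch V X A S)) : Prop :=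
  ∃ (m : ℕ) (p : Fin m → ℝ≥0) (M : Fin m → CPS Ch V X A S) (J : Finset (Fin m))
    (η : Fin m → FDist (CPS Ch V X A S)),
    (∀ i, 0 < p i) ∧ γ = ∑ i, Finsupp.single (M i) (p i) ∧ J.Nonempty ∧
    (∀ j ∈ J, (M j).HatStep α (η j)) ∧ (∀ i, i ∉ J → ¬ ∃ η', (M i).HatStep α η') ∧
    γ' = ∑ j ∈ J, p j • (η j).weights

/-- The reflexive and transitive closure of `—τ̂→`. -/
def WeakTau (γ γ' : FSub (CPS Ch V X A S)) : Prop :=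
  Relation.ReflTransGen (SubStep (Act.tau : Act Ch V)) γ γ'

/-- The weak transition `M ═α̂⇒ γ`. -/
def CPS.WeakStep (M : CPS Ch V X A S) (α : Act Ch V) (γ : FSub (CPS Ch V X A S)) : Prop :=
  (α = .tau ∧ WeakTau (dirac M).weights γ) ∨
  (α ≠ .tau ∧ ∃ γ₁ γ₂, WeakTau (dirac M).weights γ₁ ∧ SubStep α γ₁ γ₂ ∧ WeakTau γ₂ γ)

/-! ### Behavioural distance -/

/-- `ω` is a matching for `(γ, γ')`: its marginals are `γ` and `γ'`. -/
def IsMatching {α : Type} (ω : FDist (α × α)) (γ γ' : FSub α) : Prop :=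
  ω.weights.mapDomain Prod.fst = γ ∧ ω.weights.mapDomain Prod.snd = γ'

/-- The Kantorovich lifting of `d`. -/
def kantorovich {α : Type} (d : α → α → unitInterval) (γ γ' : FSub α) : unitInterval :=
  ⨅ ω ∈ {ω : FDist (α × α) | IsMatching ω γ γ'}, ω.expect fun m => d m.1 m.2

/-- `γ + (1 - |γ|) • δ Dead`. -/
def fillDead (γ : FSub (CPS Ch V X A S)) : FSub (CPS Ch V X A S) :=
  γ + Finsupp.single .dead (1 - γ.mass)

/-- The bisimulation metric functional. In the lattice `[0,1]` a supremum over the empty set is `0`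
and an infimum over the empty set is `1`. -/
def bisim (d : CPS Ch V X A S → CPS Ch V X A S → unitInterval) (M N : CPS Ch V X A S) : unitInterval :=
  ⨆ α ∈ {α : Act Ch V | (∃ γ, M.Step α γ) ∨ ∃ γ, N.Step α γ},
    max
      (⨆ γ₁ ∈ {γ₁ | M.Step α γ₁}, ⨅ γ₂ ∈ {γ₂ | N.WeakStep α γ₂},
        kantorovich d γ₁.weights (fillDead γ₂))
      (⨆ γ₂ ∈ {γ₂ | N.Step α γ₂}, ⨅ γ₁ ∈ {γ₁ | M.WeakStep α γ₁},
        kantorovich d (fillDead γ₁) γ₂.weights)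

/-- The `n`-weak bisimilarity metric: the `n`-th iterate of `bisim` from the zero function. -/
def nDist (n : ℕ) : CPS Ch V X A S → CPS Ch V X A S → unitInterval :=
  bisim^[n] fun _ _ => 0

/-! ### Grids of granularity `g` -/

/-- The points `v + h · 10⁻ᵍ`, with `h` a natural number, that lie in `J`. For an interval `J` with
left end `v` this is the discretised interval `J_g`. -/
def grid (J : Set ℝ) (v : ℝ) (g : ℕ) : Set ℝ :=
  {k | k ∈ J ∧ ∃ h : ℕ, k = v + h * ((10 : ℝ) ^ g)⁻¹}

theorem grid_Icc_finite (v w : ℝ) (g : ℕ) : (grid (Set.Icc v w) v g).Finite := by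
  refine ((Finset.range (⌊(w - v) * 10 ^ g⌋₊ + 1)).finite_toSet.image
    fun h : ℕ => v + h * ((10 : ℝ) ^ g)⁻¹).subset ?_
  rintro k ⟨hk, h, rfl⟩
  refine ⟨h, ?_, rfl⟩
  have h10 : (0 : ℝ) < 10 ^ g := by positivity
  have h1 : (h : ℝ) * ((10 : ℝ) ^ g)⁻¹ ≤ w - v := by linarith [hk.2]
  rw [← div_eq_mul_inv, div_le_iff₀ h10] at h1
  have h2 := Nat.le_floor h1
  simp only [Finset.coe_range, Set.mem_Iio]
  omega

theorem grid_Icc_nonempty {v w : ℝ} (h : v ≤ w) (g : ℕ) :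
    (grid_Icc_finite v w g).toFinset.Nonempty :=
  ⟨v, by rw [Set.Finite.mem_toFinset]; exact ⟨⟨le_rfl, h⟩, 0, by simp⟩⟩

/-- The uniform distribution on `[v, w]_g`. -/
def uniformGrid (v w : ℝ) (h : v ≤ w) (g : ℕ) : FDist ℝ :=
  uniform (grid_Icc_finite v w g).toFinset (grid_Icc_nonempty h g)

/-! ### The engine -/

/-- The only state variable. -/
inductive EngVar : Type where
  | temp

/-- The only sensor. -/
inductive EngSensor : Type where
  | st

/-- The only actuator. -/
inductive EngActuator : Type where
  | cool

/-- The uncertainty of the evolution. -/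
def delta : ℝ := 0.4

/-- The measurement error. -/
def err : ℝ := 0.1

/-- An actuator value is `off` if it is non-negative and `on` if it is negative. -/
def actOn : ℝ := -1

/-- An actuator value is `off` if it is non-negative and `on` if it is negative. -/
def actOff : ℝ := 1

open Classical in
/-- The environment of an engine of granularity `g` whose cooling system has power `r`: the
temperature grows by a uniform value in `[1-δ, 1+δ]_g` if the cooling is off and by a uniform value
in `[-r-δ, -r+δ]_g` if it is on. -/
def engEnv (r : ℝ) (g : ℕ) : Env EngVar EngActuator EngSensor where
  evol ξx ξa :=
    (if 0 ≤ ξa .cool then uniformGrid (1 - delta) (1 + delta) (by norm_num [delta]) g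
      else uniformGrid (-r - delta) (-r + delta)
        (by have : (0 : ℝ) ≤ delta := by norm_num [delta]
            linarith) g).map
      fun v _ => ξx .temp + v
  meas ξx := (uniformGrid (-err) err (by norm_num [err]) g).map fun v _ => ξx .temp + v
  inv := {ξx | 0 ≤ ξx .temp ∧ ξx .temp ≤ 30}

/-- The initial physical state: temperature `0`, sensed temperature `0`, cooling off. -/
def engState : PState EngVar EngActuator EngSensor where
  x _ := 0
  s _ := 0
  a _ := actOff

/-- Processes of the engine. -/
abbrev EngProc (Ch V : Type) : Type := Proc Ch V EngActuator EngSensor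

/-- The prefix `tick^k . P`. -/
def ticks : ℕ → EngProc Ch V → EngProc Ch V
  | 0, P => P
  | k + 1, P => .tick (.one (ticks k P))

/-- `fix Y. tick⁵. read x from st. if x > 10 then warning!ID.Y else off to cool. tick. X`.
Outside the recursion `X` is the variable `0`. The untimed prefix `warning!ID.Y` stands for
`fix Z. ⌊warning!ID.Y⌋Z`, and inside this recursion `Z` and `Y` are the variables `0` and `1`. -/
def coolingLoop (warning : Ch) (ID : V) : EngProc Ch V :=
  open Classical in
  .fix (ticks 5 (.read .st fun x => .one
    (if 10 < x then .fix (.out warning ID (.one (.var 1)) (.one (.var 0)))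
      else .write actOff .cool (.one (.tick (.one (.var 1)))))))

/-- `Cooling`: turn the cooling on and enter the cooling loop. -/
def cooling (warning : Ch) (ID : V) : EngProc Ch V :=
  .write actOn .cool (.one (coolingLoop warning ID))

/-- `Ctrl = fix X. read x from st. if x > 10 then Cooling else tick. X`. -/
def ctrl (warning : Ch) (ID : V) : EngProc Ch V :=
  open Classical in
  .fix (.read .st fun x => .one
    (if 10 < x then cooling warning ID else .tick (.one (.var 0))))

/-- The engine with cooling power `r` and granularity `g`. -/
def engine (warning : Ch) (ID : V) (r : ℝ) (g : ℕ) :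
    CPS Ch V EngVar EngActuator EngSensor :=
  .sys (engEnv r g) engState (ctrl warning ID)

/-- The engine `Eng_g`. -/
def Eng (warning : Ch) (ID : V) (g : ℕ) : CPS Ch V EngVar EngActuator EngSensor :=
  engine warning ID 1 g

/-- The variant of `Eng_g` whose cooling power is reduced by 30%. -/
def EngHat (warning : Ch) (ID : V) (g : ℕ) : CPS Ch V EngVar EngActuator EngSensor :=
  engine warning ID 0.7 g

/-- `p_g = |[0.3, 0.4)_g| / |[0.3, 1.1]_g|`. -/
def pRatio (g : ℕ) : ℝ :=
  ((grid (Set.Ico 0.3 0.4) 0.3 g).ncard : ℝ) / ((grid (Set.Icc 0.3 1.1) 0.3 g).ncard : ℝ)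

/-- `q_g = |(1.3, 1.4]_g| / |[0.6, 1.4]_g|`. -/
def qRatio (g : ℕ) : ℝ :=
  ((grid (Set.Ioc 1.3 1.4) 1.3 g).ncard : ℝ) / ((grid (Set.Icc 0.6 1.4) 0.6 g).ncard : ℝ)

end ProbCPS

end

-- The full-power engine never raises a warning, so the distance is paid for only by the chance that
-- the weak engine does. A state of the weak engine carries a risk `ρ`, a bound on the probability
-- that the current cooling round ends in a warning, and the distance from any reachable full-power
-- state is at most `1 - (1 - ρ) b ^ n` with `b = 1 - q p ^ 5`. Initially `ρ = 0`.
--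
-- The sensor errs by at most `0.1`. Waiting therefore happens at temperatures up to `10.1`, and
-- cooling starts between `9.9` and `11.5`. Weak cooling lowers the temperature by at least `0.3`
-- per slot, so after `j` slots it is at most `11.5 - 0.3 j`. Below `11.4 - 0.3 j` it stays below
-- the moving threshold, and after five slots it is at most `9.9`, so that the sensor shows at most
-- `10`. A state above the threshold remains above only if the next drop is less than `0.4`, which
-- has probability at most `p`; hence the risk `p ^ (5 - j)`. To start a round above `11.4`, the
-- last heating step must exceed `1.3`, which has probability at most `q`. Thus expected risk grows
-- only when waiting ends, from `0` to at most `q p ^ 5`, which costs one factor `b`.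
--
-- Outside warnings each system has exactly one transition, and a tick is always reachable by
-- finitely many `τ`. A `τ` is answered by staying put and a tick by a weak tick. The bound ignores
-- the full-power state, so the independent coupling suffices. This argument is `nDist_le`;
-- `engSys_step` and `engSys_weakStep` supply its hypotheses, and `mean_uniformGrid_tail` the
-- probabilities.

namespace ProbCPS

/-! ### Expectations under finite-support distributions -/

/-- The expectation of a real-valued function. -/
noncomputable def FDist.mean {α : Type} (μ : FDist α) (f : α → ℝ) : ℝ :=
  μ.weights.sum fun a r => (r : ℝ) * f a

/-- Every point of positive weight satisfies `p`. -/
def FDist.Forall {α : Type} (μ : FDist α) (p : α → Prop) : Prop :=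
  ∀ a, μ.weights a ≠ 0 → p a

section Mean

variable {α β : Type}

theorem FDist.coe_expect (μ : FDist α) (f : α → unitInterval) :
    (μ.expect f : ℝ) = μ.mean fun a => f a := rfl

theorem FDist.mean_dirac (a : α) (f : α → ℝ) : (dirac a).mean f = f a := by
  simp [FDist.mean, dirac]

theorem FDist.mean_const (μ : FDist α) (c : ℝ) : (μ.mean fun _ => c) = c := by
  have h : ((μ.weights.sum fun _ r => r : ℝ≥0) : ℝ) = 1 := by rw [μ.total]; rfl
  rw [Finsupp.sum, NNReal.coe_sum] at h
  rw [FDist.mean, Finsupp.sum, ← Finset.sum_mul, h, one_mul]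

theorem FDist.mean_mono {μ : FDist α} {f g : α → ℝ} (h : μ.Forall fun a => f a ≤ g a) :
    μ.mean f ≤ μ.mean g :=
  Finset.sum_le_sum fun a ha =>
    mul_le_mul_of_nonneg_left (h a (Finsupp.mem_support_iff.1 ha)) (NNReal.coe_nonneg _)

theorem FDist.mean_mul_left (μ : FDist α) (c : ℝ) (f : α → ℝ) :
    (μ.mean fun a => c * f a) = c * μ.mean f := by
  simp only [FDist.mean, Finsupp.sum, Finset.mul_sum]
  exact Finset.sum_congr rfl fun a _ => by ring

theorem FDist.mean_one_sub (μ : FDist α) (f : α → ℝ) :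
    (μ.mean fun a => 1 - f a) = 1 - μ.mean f := by
  have h := μ.mean_const 1
  simp only [FDist.mean, Finsupp.sum, mul_sub, Finset.sum_sub_distrib] at h ⊢
  rw [h]

theorem FDist.mean_map (μ : FDist α) (g : α → β) (f : β → ℝ) :
    FDist.mean (μ.map g) f = μ.mean fun a => f (g a) := by
  simp only [FDist.mean, StdSimplex.weights_map]
  exact Finsupp.sum_mapDomain_index (fun _ => by simp) fun _ _ _ => by push_cast; ring

theorem FDist.weights_bind (μ : FDist α) (g : α → FDist β) :
    (μ.bind g).weights = μ.weights.sum fun a r => r • (g a).weights := by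
  simp [FDist.bind, iConvexComb, Finsupp.sum_mapDomain_index, add_smul]

theorem FDist.mean_bind (μ : FDist α) (g : α → FDist β) (f : β → ℝ) :
    (μ.bind g).mean f = μ.mean fun a => (g a).mean f := by
  simp only [FDist.mean, FDist.weights_bind]
  rw [Finsupp.sum_sum_index (fun _ => by simp) fun _ _ _ => by push_cast; ring]
  refine Finsupp.sum_congr fun a _ => ?_
  rw [Finsupp.sum_smul_index (fun _ => by simp), Finsupp.sum, Finsupp.sum, Finset.mul_sum]
  exact Finset.sum_congr rfl fun b _ => by push_cast; ring

theorem uniform_weights {s : Finset α} (hs : s.Nonempty) (a : α) [Decidable (a ∈ s)] :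
    (uniform s hs).weights a = if a ∈ s then 1 / (s.card : ℝ≥0) else 0 := by
  classical
  simp only [uniform, Finsupp.finsetSum_apply, Finsupp.single_apply, Finset.sum_ite_eq']
  congr

theorem mean_uniform {s : Finset α} (hs : s.Nonempty) (f : α → ℝ) :
    (uniform s hs).mean f = (∑ a ∈ s, f a) / s.card := by
  classical
  rw [FDist.mean, Finsupp.sum_of_support_subset (s := s), Finset.sum_div]
  · refine Finset.sum_congr rfl fun a ha => ?_
    rw [uniform_weights, if_pos ha]
    push_cast
    ring
  · intro a ha
    rw [Finsupp.mem_support_iff, uniform_weights] at ha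
    by_contra h
    exact ha (if_neg h)
  · simp

theorem FDist.forall_uniform {s : Finset α} (hs : s.Nonempty) {p : α → Prop}
    (h : ∀ a ∈ s, p a) : (uniform s hs).Forall p := by
  classical
  intro a ha
  rw [uniform_weights] at ha
  by_contra hp
  exact ha (if_neg fun hm => hp (h a hm))

theorem FDist.forall_map {μ : FDist α} {g : α → β} {p : β → Prop}
    (h : μ.Forall fun a => p (g a)) : FDist.Forall (μ.map g) p := by
  classical
  intro b hb
  rw [StdSimplex.weights_map] at hb
  have := Finsupp.mapDomain_support (Finsupp.mem_support_iff.2 hb)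
  obtain ⟨a, ha, rfl⟩ := Finset.mem_image.1 this
  exact h a (Finsupp.mem_support_iff.1 ha)

theorem FDist.forall_bind {μ : FDist α} {g : α → FDist β} {p : β → Prop}
    (h : μ.Forall fun a => (g a).Forall p) : (μ.bind g).Forall p := by
  intro b hb
  rw [FDist.weights_bind, Finsupp.sum, Finsupp.finsetSum_apply] at hb
  obtain ⟨a, ha, hab⟩ := Finset.exists_ne_zero_of_sum_ne_zero hb
  refine h a (Finsupp.mem_support_iff.1 ha) b fun h0 => hab ?_
  rw [Finsupp.smul_apply, h0, smul_zero]

theorem FDist.forall_dirac {a : α} {p : α → Prop} (h : p a) : (dirac a).Forall p := by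
  classical
  intro b hb
  rw [dirac, StdSimplex.weights_single, Finsupp.single_apply] at hb
  by_cases hab : a = b
  · exact hab ▸ h
  · exact absurd (if_neg hab) hb

theorem FDist.Forall.mono {μ : FDist α} {p q : α → Prop} (h : μ.Forall p)
    (hpq : ∀ a, p a → q a) : μ.Forall q :=
  fun a ha => hpq a (h a ha)

theorem FDist.map_dirac (a : α) (g : α → β) : StdSimplex.map g (dirac a) = dirac (g a) := by
  simp [dirac]

theorem FDist.bind_dirac_comp (μ : FDist α) (g : α → β) :
    (μ.bind fun a => dirac (g a)) = μ.map g := by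
  ext1
  rw [FDist.weights_bind, StdSimplex.weights_map, Finsupp.mapDomain]
  exact Finsupp.sum_congr fun a _ => by simp [dirac]

theorem FDist.map_bind {γ : Type} (μ : FDist α) (g : α → FDist β) (f : β → γ) :
    StdSimplex.map f (μ.bind g) = μ.bind fun a => (g a).map f := by
  simp [FDist.bind, iConvexComb, StdSimplex.map_sConvexComb, StdSimplex.map_map]

theorem FDist.bind_const (μ : FDist α) (ν : FDist β) : (μ.bind fun _ => ν) = ν := by
  simp [FDist.bind]

/-- The independent coupling of two image distributions bounds the Kantorovich lifting. -/
theorem kantorovich_map_le {γ : Type} {d : γ → γ → unitInterval} {e : α → γ} {e' : β → γ}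
    {μ : FDist α} {ν : FDist β} {f : β → ℝ}
    (h : μ.Forall fun a => ν.Forall fun b => (d (e a) (e' b) : ℝ) ≤ f b) :
    (kantorovich d (StdSimplex.map e μ).weights (StdSimplex.map e' ν).weights : ℝ)
      ≤ ν.mean f := by
  have hm : IsMatching (μ.bind fun a => ν.map fun b => (e a, e' b))
      (StdSimplex.map e μ).weights (StdSimplex.map e' ν).weights := by
    constructor <;> rw [← StdSimplex.weights_map, FDist.map_bind]
    · simp only [StdSimplex.map_map, StdSimplex.map_const]
      exact congrArg _ (FDist.bind_dirac_comp μ e)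
    · simp only [StdSimplex.map_map]
      rw [FDist.bind_const]
  have hle : kantorovich d (StdSimplex.map e μ).weights (StdSimplex.map e' ν).weights ≤
      (μ.bind fun a => ν.map fun b => (e a, e' b)).expect fun m => d m.1 m.2 :=
    iInf₂_le (f := fun (ω : FDist (γ × γ)) (_ : ω ∈ {ω | IsMatching ω _ _}) =>
      ω.expect fun m => d m.1 m.2) _ hm
  refine (Subtype.coe_le_coe.2 hle).trans ?_
  -- The bound does not involve the first component, so the right side is a constant averaged over
  -- `μ`.
  rw [FDist.coe_expect, FDist.mean_bind, ← μ.mean_const (ν.mean f)]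
  refine FDist.mean_mono fun a ha => ?_
  beta_reduce
  rw [FDist.mean_map]
  exact FDist.mean_mono (h a ha)

end Mean

/-! ### Bounding the metric -/

section Metric

variable {Ch V A S X : Type}

/-- No mass is missing from a full distribution. Every answering transition used below reaches one,
so the completion by `Dead` plays no role. -/
theorem fillDead_weights (γ : FDist (CPS Ch V X A S)) : fillDead γ.weights = γ.weights := by
  have h : FSub.mass γ.weights = 1 := γ.total
  simp [fillDead, h]

theorem CPS.HatStep.subStep {M : CPS Ch V X A S} {α : Act Ch V} {γ : FDist (CPS Ch V X A S)}
    (h : M.HatStep α γ) : SubStep α (dirac M).weights γ.weights :=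
  -- A decomposition with one summand and `J` everything, so the clause about immobile summands is
  -- vacuous.
  ⟨1, fun _ => 1, fun _ => M, Finset.univ, fun _ => γ, by simp, by simp [dirac], by simp,
    fun _ _ => h, by simp, by simp⟩

theorem CPS.weakStep_stay (M : CPS Ch V X A S) : M.WeakStep .tau (dirac M).weights :=
  .inl ⟨rfl, .refl⟩

theorem CPS.Step.weakStep {M : CPS Ch V X A S} {γ : FDist (CPS Ch V X A S)}
    (h : M.Step .tick γ) : M.WeakStep .tick γ.weights :=
  .inr ⟨nofun, _, _, .refl, CPS.HatStep.subStep (.inl h), .refl⟩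

theorem CPS.Step.weakStep_cons {M M' : CPS Ch V X A S} {γ : FSub (CPS Ch V X A S)}
    (h : M.Step .tau (dirac M')) (h' : M'.WeakStep .tick γ) : M.WeakStep .tick γ := by
  rcases h' with ⟨h', -⟩ | ⟨-, γ₁, γ₂, h₁, h₂, h₃⟩
  · cases h'
  · exact .inr ⟨nofun, γ₁, γ₂, .head (CPS.HatStep.subStep (.inl h)) h₁, h₂, h₃⟩

/-- Replaces the lattice operations of `[0,1]` by a choice of answer to each move, with a real bound
`c`. A `c` above `1` is harmless, as distances never exceed `1`. -/
theorem bisim_le {d : CPS Ch V X A S → CPS Ch V X A S → unitInterval} {M N : CPS Ch V X A S}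
    {c : ℝ} (hc : 0 ≤ c)
    (hM : ∀ α γ₁, M.Step α γ₁ →
      ∃ γ₂, N.WeakStep α γ₂ ∧ (kantorovich d γ₁.weights (fillDead γ₂) : ℝ) ≤ c)
    (hN : ∀ α γ₂, N.Step α γ₂ →
      ∃ γ₁, M.WeakStep α γ₁ ∧ (kantorovich d (fillDead γ₁) γ₂.weights : ℝ) ≤ c) :
    (bisim d M N : ℝ) ≤ c := by
  rcases le_total 1 c with h1 | h1
  · exact (bisim d M N).2.2.trans h1
  · change bisim d M N ≤ (⟨c, hc, h1⟩ : unitInterval)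
    refine iSup₂_le fun α _ => max_le (iSup₂_le fun γ₁ h => ?_) (iSup₂_le fun γ₂ h => ?_)
    · obtain ⟨γ₂, hw, hk⟩ := hM α γ₁ h
      exact iInf₂_le_of_le γ₂ hw hk
    · obtain ⟨γ₁, hw, hk⟩ := hN α γ₂ h
      exact iInf₂_le_of_le γ₁ hw hk

/-- `M` has exactly one transition. -/
def CPS.OnlyStep (M : CPS Ch V X A S) (α : Act Ch V) (γ : FDist (CPS Ch V X A S)) : Prop :=
  ∀ α' γ', M.Step α' γ' ↔ α' = α ∧ γ' = γ

theorem CPS.OnlyStep.step {M : CPS Ch V X A S} {α : Act Ch V} {γ : FDist (CPS Ch V X A S)}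
    (h : M.OnlyStep α γ) : M.Step α γ :=
  (h α γ).2 ⟨rfl, rfl⟩

/-- A family of systems that evolve deterministically up to the probabilistic choices made when
time passes, and that can always let time pass, is at distance at most `f n j` from a second such
family, provided that `f` bounds its own expectation after each transition. Where `f` is at least
`1` nothing is required of the second family. -/
theorem nDist_le {I J : Type} {e : I → CPS Ch V X A S} {e' : J → CPS Ch V X A S}
    {p : I → Prop} {p' : J → Prop} {f : ℕ → J → ℝ} (hf : ∀ n j, 0 ≤ f n j)
    (h : ∀ i, p i →
      ((∃ i', p i' ∧ (e i).OnlyStep .tau (dirac (e i'))) ∨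
        ∃ μ : FDist I, μ.Forall p ∧ (e i).OnlyStep .tick (μ.map e)) ∧
      ∃ μ : FDist I, μ.Forall p ∧ (e i).WeakStep .tick (StdSimplex.map e μ).weights)
    (h' : ∀ n j, p' j → f (n + 1) j < 1 →
      f n j ≤ f (n + 1) j ∧
      ((∃ j', p' j' ∧ f n j' ≤ f (n + 1) j ∧ (e' j).OnlyStep .tau (dirac (e' j'))) ∨
        ∃ ν : FDist J, ν.Forall p' ∧ ν.mean (f n) ≤ f (n + 1) j ∧
          (e' j).OnlyStep .tick (ν.map e')) ∧
      ∃ ν : FDist J, ν.Forall p' ∧ ν.mean (f n) ≤ f (n + 1) j ∧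
        (e' j).WeakStep .tick (StdSimplex.map e' ν).weights)
    (n : ℕ) : ∀ i j, p i → p' j → (nDist n (e i) (e' j) : ℝ) ≤ f n j := by
  induction n with
  | zero => exact fun i j _ _ => hf 0 j
  | succ n ih =>
    intro i j hi hj
    rcases le_or_gt 1 (f (n + 1) j) with h1 | h1
    · exact (nDist (n + 1) (e i) (e' j)).2.2.trans h1
    -- Since `f n` depends on the second index only, no correlation between the two systems is
    -- needed.
    have key {μ : FDist I} {ν : FDist J} (hμ : μ.Forall p) (hν : ν.Forall p') :
        (kantorovich (nDist n) (StdSimplex.map e μ).weights (StdSimplex.map e' ν).weights : ℝ)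
          ≤ ν.mean (f n) :=
      kantorovich_map_le fun a ha b hb => ih a b (hμ a ha) (hν b hb)
    have key₁ {i' : I} {j' : J} (hi' : p i') (hj' : p' j') :
        (kantorovich (nDist n) (dirac (e i')).weights (dirac (e' j')).weights : ℝ) ≤ f n j' := by
      have := key (FDist.forall_dirac hi') (FDist.forall_dirac hj')
      rwa [FDist.map_dirac, FDist.map_dirac, FDist.mean_dirac] at this
    obtain ⟨hs, μ, hμ, hμw⟩ := h i hi
    obtain ⟨hmono, hs', ν, hν, hνf, hνw⟩ := h' n j hj h1
    rw [nDist, Function.iterate_succ_apply', ← nDist]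
    refine bisim_le (hf _ _) (fun α γ hγ => ?_) fun α γ hγ => ?_
    -- An instantaneous move is answered by idling, a tick by a weak tick.
    · rcases hs with ⟨i', hi', ho⟩ | ⟨μ', hμ', ho⟩ <;> obtain ⟨rfl, rfl⟩ := (ho _ _).1 hγ
      · refine ⟨_, CPS.weakStep_stay _, ?_⟩
        rw [fillDead_weights]
        exact (key₁ hi' hj).trans hmono
      · refine ⟨_, hνw, ?_⟩
        rw [fillDead_weights]
        exact (key hμ' hν).trans hνf
    · rcases hs' with ⟨j', hj', hle, ho⟩ | ⟨ν', hν', hle, ho⟩ <;>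
        obtain ⟨rfl, rfl⟩ := (ho _ _).1 hγ
      · refine ⟨_, CPS.weakStep_stay _, ?_⟩
        rw [fillDead_weights]
        exact (key₁ hi hj').trans hle
      · refine ⟨_, hμw, ?_⟩
        rw [fillDead_weights]
        exact (key hμ hν').trans hle

end Metric

/-! ### Systems with a single transition -/

section OnlyStep

variable {Ch V A S X : Type}

theorem Proc.step_read_iff {s : S} {k : ℝ → Choice Ch V A S} {l : Label Ch V A S}
    {π : FDist (Proc Ch V A S)} :
    (Proc.read s k).Step l π ↔ ∃ v, l = .read s v ∧ π = (k v).sem := by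
  constructor
  · rintro ⟨⟩
    exact ⟨_, rfl, rfl⟩
  · rintro ⟨v, rfl, rfl⟩
    exact .read s v k

theorem Proc.step_write_iff {v : ℝ} {a : A} {C : Choice Ch V A S} {l : Label Ch V A S}
    {π : FDist (Proc Ch V A S)} :
    (Proc.write v a C).Step l π ↔ l = .write a v ∧ π = C.sem := by
  constructor
  · rintro ⟨⟩
    exact ⟨rfl, rfl⟩
  · rintro ⟨rfl, rfl⟩
    exact .write v a C

theorem Proc.not_step_tick {C : Choice Ch V A S} {l : Label Ch V A S}
    {π : FDist (Proc Ch V A S)} : ¬ (Proc.tick C).Step l π := by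
  rintro ⟨⟩

theorem Proc.tick_tick_iff {C : Choice Ch V A S} {π : FDist (Proc Ch V A S)} :
    (Proc.tick C).Tick π ↔ π = C.sem := by
  constructor
  · rintro ⟨⟩
    rfl
  · rintro rfl
    exact .delay C

theorem Proc.step_fix_iff {P : Proc Ch V A S} {l : Label Ch V A S}
    {π : FDist (Proc Ch V A S)} : (Proc.fix P).Step l π ↔ P.unfold.Step l π := by
  constructor
  · rintro ⟨⟩
    assumption
  · exact .fix

theorem Proc.tick_fix_iff {P : Proc Ch V A S} {π : FDist (Proc Ch V A S)} :
    (Proc.fix P).Tick π ↔ P.unfold.Tick π := by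
  constructor
  · rintro ⟨⟩
    assumption
  · exact .fix

theorem Choice.sem_one (P : Proc Ch V A S) : (Choice.one P).sem = dirac P := by
  simp [Choice.one, Choice.sem, dirac]

theorem sysDist_dirac (E : Env X A S) (ρ : FDist (PState X A S)) (P : Proc Ch V A S) :
    sysDist E ρ (dirac P) = ρ.map fun σ => CPS.sys E σ P := by
  simp only [sysDist, FDist.map_dirac, FDist.bind_dirac_comp]

/-- The process offers a read of every value, but the physical state selects one. The resulting `τ`
blocks time, and the invariant excludes deadlock. -/
theorem CPS.onlyStep_read {E : Env X A S} {σ : PState X A S} {P : Proc Ch V A S} {s : S}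
    {k : ℝ → Proc Ch V A S} (hσ : σ.x ∈ E.inv)
    (hP : ∀ l π, P.Step l π ↔ ∃ v, l = .read s v ∧ π = dirac (k v)) :
    (CPS.sys E σ P).OnlyStep .tau (dirac (.sys E σ (k (σ.s s)))) := by
  have hstep : CPS.UStep (.sys E σ P) .tau (dirac (.sys E σ (k (σ.s s)))) := by
    have := CPS.UStep.sensRead (E := E) ((hP _ _).2 ⟨σ.s s, rfl, rfl⟩) hσ
    rwa [sysDist_dirac, FDist.map_dirac] at this
  intro α γ
  constructor
  · rintro (h | ⟨-, hn, -⟩)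
    · cases h <;> rename_i h
      case deadlock => exact absurd hσ h
      all_goals
        obtain ⟨v, hv, rfl⟩ := (hP _ _).1 ‹P.Step _ _›
        cases hv
      -- Only the sensor rule survives, since the other rules require a label that is not a read.
      rw [sysDist_dirac, FDist.map_dirac]
      exact ⟨rfl, rfl⟩
    · exact absurd ⟨_, hstep⟩ hn
  · rintro ⟨rfl, rfl⟩
    exact .untimed hstep

theorem CPS.onlyStep_write {E : Env X A S} {σ : PState X A S} {P : Proc Ch V A S} {a : A} {v : ℝ}
    {Q : Proc Ch V A S} (hσ : σ.x ∈ E.inv)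
    (hP : ∀ l π, P.Step l π ↔ l = .write a v ∧ π = dirac Q) :
    (CPS.sys E σ P).OnlyStep .tau (dirac (.sys E (σ.setAct a v) Q)) := by
  have hstep : CPS.UStep (.sys E σ P) .tau (dirac (.sys E (σ.setAct a v) Q)) := by
    have := CPS.UStep.actWrite (E := E) ((hP _ _).2 ⟨rfl, rfl⟩) hσ
    rwa [sysDist_dirac, FDist.map_dirac] at this
  intro α γ
  constructor
  · rintro (h | ⟨-, hn, -⟩)
    · cases h <;> rename_i h
      case deadlock => exact absurd hσ h
      all_goals
        obtain ⟨hv, rfl⟩ := (hP _ _).1 ‹P.Step _ _›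
        cases hv
      rw [sysDist_dirac, FDist.map_dirac]
      exact ⟨rfl, rfl⟩
    · exact absurd ⟨_, hstep⟩ hn
  · rintro ⟨rfl, rfl⟩
    exact .untimed hstep

theorem CPS.onlyStep_tick {E : Env X A S} {σ : PState X A S} {P Q : Proc Ch V A S}
    (hσ : σ.x ∈ E.inv) (hP : ∀ l π, ¬ P.Step l π) (hP' : ∀ π, P.Tick π ↔ π = dirac Q) :
    (CPS.sys E σ P).OnlyStep .tick ((E.next σ).map fun σ' => .sys E σ' Q) := by
  have hn : ∀ α γ, ¬ CPS.UStep (.sys E σ P) α γ := by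
    rintro α γ h
    cases h
    case deadlock h => exact h hσ
    all_goals exact hP _ _ ‹P.Step _ _›
  intro α γ
  constructor
  · rintro (h | ⟨h, -, -⟩)
    · exact absurd h (hn _ _)
    · obtain rfl := (hP' _).1 h
      exact ⟨rfl, sysDist_dirac _ _ _⟩
  · rintro ⟨rfl, rfl⟩
    rw [← sysDist_dirac]
    exact .time ((hP' _).2 rfl) (fun ⟨γ, h⟩ => hn _ γ h) hσ

end OnlyStep

/-! ### Counting grid points -/

section Grid

/-- The proportion of the last tenth-long piece in a discretised interval of length `0.8`. -/
noncomputable def tailProb (g : ℕ) : ℝ := 1 / (8 + (10 : ℝ) ^ (1 - (g : ℤ)))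

theorem tailProb_nonneg (g : ℕ) : 0 ≤ tailProb g := by
  unfold tailProb
  positivity

theorem tailProb_le_one (g : ℕ) : tailProb g ≤ 1 := by
  have : (0 : ℝ) < 10 ^ (1 - (g : ℤ)) := by positivity
  rw [tailProb, div_le_one (by linarith)]
  linarith

theorem tailProb_succ (m : ℕ) :
    tailProb (m + 1) = ((10 ^ m : ℕ) : ℝ) / ((8 * 10 ^ m + 1 : ℕ) : ℝ) := by
  have h : (1 - ((m + 1 : ℕ) : ℤ)) = -(m : ℤ) := by push_cast; ring
  have h10 : (10 : ℝ) ^ m ≠ 0 := by positivity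
  rw [tailProb, h, zpow_neg, zpow_natCast]
  push_cast
  field_simp

theorem grid_eq_image (J : Set ℝ) (v : ℝ) (g : ℕ) :
    grid J v g = (fun h : ℕ => v + h * ((10 : ℝ) ^ g)⁻¹) '' {h | v + h * ((10 : ℝ) ^ g)⁻¹ ∈ J} := by
  ext k
  constructor
  · rintro ⟨hk, h, rfl⟩
    exact ⟨h, hk, rfl⟩
  · rintro ⟨h, hk, rfl⟩
    exact ⟨hk, h, rfl⟩

theorem gridPoint_injective (v : ℝ) (g : ℕ) :
    Function.Injective fun h : ℕ => v + h * ((10 : ℝ) ^ g)⁻¹ := by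
  intro a b hab
  have h10 : ((10 : ℝ) ^ g)⁻¹ ≠ 0 := by positivity
  have := mul_right_cancel₀ h10 (add_left_cancel hab)
  exact_mod_cast this

theorem ncard_grid {J : Set ℝ} {v : ℝ} {g : ℕ} {s : Finset ℕ}
    (h : ∀ h : ℕ, v + h * ((10 : ℝ) ^ g)⁻¹ ∈ J ↔ h ∈ s) : (grid J v g).ncard = s.card := by
  rw [grid_eq_image, Set.ncard_image_of_injective _ (gridPoint_injective v g),
    ← Set.ncard_coe_finset]
  congr 1
  ext k
  exact h k

/-- With `g = m + 1`, a tenth is exactly `10 ^ m` grid steps, so cut-offs at multiples of `0.1`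
become comparisons of natural numbers. -/
theorem gridStep_le_iff (m h k : ℕ) :
    (h : ℝ) * ((10 : ℝ) ^ (m + 1))⁻¹ ≤ k * 0.1 ↔ h ≤ k * 10 ^ m := by
  have h10 : (0 : ℝ) < 10 ^ (m + 1) := by positivity
  rw [← div_eq_mul_inv, div_le_iff₀ h10, ← Nat.cast_le (α := ℝ)]
  push_cast
  rw [pow_succ]
  constructor <;> intro h <;> linarith

theorem gridStep_lt_iff (m h k : ℕ) :
    (k : ℝ) * 0.1 < (h : ℝ) * ((10 : ℝ) ^ (m + 1))⁻¹ ↔ k * 10 ^ m < h := by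
  rw [← not_le, gridStep_le_iff, not_le]

theorem gridPoint_mem_Icc_iff {v w : ℝ} (hw : w = v + 0.8) (m h : ℕ) :
    v + h * ((10 : ℝ) ^ (m + 1))⁻¹ ∈ Set.Icc v w ↔ h ∈ Finset.range (8 * 10 ^ m + 1) := by
  have h8 := gridStep_le_iff m h 8
  have h0 : 0 ≤ (h : ℝ) * ((10 : ℝ) ^ (m + 1))⁻¹ := by positivity
  rw [Finset.mem_range, Nat.lt_succ_iff, ← h8, hw]
  push_cast
  constructor
  · intro hm
    linarith [hm.2]
  · intro hm
    constructor <;> linarith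

theorem pRatio_eq_tailProb {g : ℕ} (hg : 1 ≤ g) : pRatio g = tailProb g := by
  obtain ⟨m, rfl⟩ := Nat.exists_eq_add_of_le' hg
  rw [tailProb_succ, pRatio, ncard_grid (gridPoint_mem_Icc_iff (by norm_num) m),
    -- The point `0.4` has index `10 ^ m` and is excluded.
    ncard_grid (s := Finset.range (10 ^ m)), Finset.card_range, Finset.card_range]
  intro h
  have h0 : 0 ≤ (h : ℝ) * ((10 : ℝ) ^ (m + 1))⁻¹ := by positivity
  have h2 : (h : ℝ) * ((10 : ℝ) ^ (m + 1))⁻¹ < 0.1 ↔ h < 10 ^ m := by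
    have hk : (0.1 : ℝ) = ((10 ^ m : ℕ) : ℝ) * ((10 : ℝ) ^ (m + 1))⁻¹ := by
      push_cast
      rw [pow_succ]
      field_simp
      norm_num
    rw [hk, mul_lt_mul_iff_left₀ (by positivity), Nat.cast_lt]
  rw [Finset.mem_range, ← h2]
  constructor
  · intro hm
    linarith [hm.2]
  · intro hm
    constructor <;> linarith

theorem qRatio_eq_tailProb {g : ℕ} (hg : 1 ≤ g) : qRatio g = tailProb g := by
  obtain ⟨m, rfl⟩ := Nat.exists_eq_add_of_le' hg
  rw [tailProb_succ, qRatio, ncard_grid (gridPoint_mem_Icc_iff (by norm_num) m),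
    -- Here the grid starts at the excluded end `1.3`, so index `0` is dropped and index `10 ^ m`
    -- kept.
    ncard_grid (s := Finset.Ioc 0 (10 ^ m)), Finset.card_range, Nat.card_Ioc, Nat.sub_zero]
  intro h
  have h1 := gridStep_le_iff m h 1
  have h0 := gridStep_lt_iff m h 0
  rw [one_mul] at h1
  rw [zero_mul] at h0
  rw [Finset.mem_Ioc, ← h1, ← h0]
  push_cast
  constructor
  · rintro ⟨h3, h4⟩
    constructor <;> linarith
  · rintro ⟨h3, h4⟩
    constructor <;> linarith

/-- The tail has indices from `7 * 10 ^ m + 1` to `8 * 10 ^ m`. It serves both regimes: rises above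
`1.3`, and at power `0.7` drops below `0.4`. The latter are counted by `pRatio` from the opposite
end after a change of sign. -/
theorem mean_uniformGrid_tail {g : ℕ} (hg : 1 ≤ g) {v w : ℝ} (h : v ≤ w) (hw : w = v + 0.8) :
    (uniformGrid v w h g).mean (fun k => if k ≤ v + 0.7 then 0 else 1) = tailProb g := by
  obtain ⟨m, rfl⟩ := Nat.exists_eq_add_of_le' hg
  have hs : (grid_Icc_finite v w (m + 1)).toFinset =
      (Finset.range (8 * 10 ^ m + 1)).image fun h : ℕ => v + h * ((10 : ℝ) ^ (m + 1))⁻¹ := by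
    ext k
    rw [Set.Finite.mem_toFinset, grid_eq_image, Finset.mem_image]
    simp only [Set.mem_image, Set.mem_ofPred_eq, gridPoint_mem_Icc_iff hw]
  have hinj := gridPoint_injective v (m + 1)
  rw [uniformGrid, mean_uniform, hs, Finset.card_image_of_injective _ hinj,
    Finset.sum_image fun a _ b _ hab => hinj hab, Finset.card_range, tailProb_succ]
  congr 1
  have h7 (k : ℕ) : v + k * ((10 : ℝ) ^ (m + 1))⁻¹ ≤ v + 0.7 ↔ k ≤ 7 * 10 ^ m := by
    rw [← gridStep_le_iff m k 7, add_le_add_iff_left]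
    norm_num
  have hf : (Finset.range (8 * 10 ^ m + 1)).filter (fun k => ¬ k ≤ 7 * 10 ^ m) =
      Finset.Ioc (7 * 10 ^ m) (8 * 10 ^ m) := by
    ext k
    simp only [Finset.mem_filter, Finset.mem_range, Finset.mem_Ioc]
    omega
  simp only [h7]
  rw [Finset.sum_ite, Finset.sum_const_zero, zero_add, hf, Finset.sum_const,
    Nat.card_Ioc, nsmul_eq_mul, mul_one]
  congr 1
  omega

theorem forall_uniformGrid {v w : ℝ} (h : v ≤ w) (g : ℕ) :
    (uniformGrid v w h g).Forall fun k => v ≤ k ∧ k ≤ w :=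
  FDist.forall_uniform _ fun k hk => by
    rw [Set.Finite.mem_toFinset] at hk
    exact hk.1

end Grid

/-! ### The reachable states of the engine -/

section Engine

variable {Ch V : Type}

/-- Physical states of the engine. -/
abbrev EngPState : Type := PState EngVar EngActuator EngSensor

/-- The control states of the engine in which no warning has been raised; `loop j` is the cooling
loop after `j` time slots. -/
inductive Phase : Type where
  | ctrl
  | wait
  | start
  | loop (j : ℕ)
  | finish

theorem Choice.subst_one (Q P : EngProc Ch V) (i : ℕ) :
    Choice.subst Q i (.one P) = .one (Proc.subst Q i P) := by
  simp [Choice.one, Choice.subst]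

theorem subst_ite (p : Prop) [Decidable p] (Q P P' : EngProc Ch V) (i : ℕ) :
    Proc.subst Q i (if p then P else P') =
      if p then Proc.subst Q i P else Proc.subst Q i P' :=
  apply_ite _ _ _ _

theorem subst_ticks (Q P : EngProc Ch V) (i k : ℕ) :
    Proc.subst Q i (ticks k P) = ticks k (Proc.subst Q i P) := by
  induction k with
  | zero => rfl
  | succ k ih => simp only [ticks, Proc.subst, Choice.subst_one, ih]

/-- The controller is closed, so later unfoldings of the cooling loop leave its copies untouched. -/
theorem subst_ctrl (warning : Ch) (ID : V) (Q : EngProc Ch V) (i : ℕ) :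
    Proc.subst Q i (ctrl warning ID) = ctrl warning ID := by
  simp [ctrl, cooling, coolingLoop, Proc.subst, Choice.subst_one, subst_ticks, subst_ite]

open Classical in
/-- The cooling loop with the controller substituted for its free variable. -/
noncomputable def closedLoop (warning : Ch) (ID : V) : EngProc Ch V :=
  .fix (ticks 5 (.read .st fun x => .one
    (if 10 < x then .fix (.out warning ID (.one (.var 1)) (.one (.var 0)))
      else .write actOff .cool (.one (.tick (.one (ctrl warning ID)))))))

/-- The process that raises the warning until it is received and then re-enters the cooling
loop. -/
noncomputable def warn (warning : Ch) (ID : V) : EngProc Ch V :=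
  .fix (.out warning ID (.one (closedLoop warning ID)) (.one (.var 0)))

open Classical in
/-- The last action of a round of the cooling loop. -/
noncomputable def loopRead (warning : Ch) (ID : V) : EngProc Ch V :=
  .read .st fun x => .one
    (if 10 < x then warn warning ID
      else .write actOff .cool (.one (.tick (.one (ctrl warning ID)))))

theorem subst_coolingLoop (warning : Ch) (ID : V) :
    Proc.subst (ctrl warning ID) 0 (coolingLoop warning ID) = closedLoop warning ID := by
  simp [coolingLoop, closedLoop, Proc.subst, Choice.subst_one, subst_ticks, subst_ite]

/-- The process of a control state. -/
noncomputable def Phase.proc (warning : Ch) (ID : V) : Phase → EngProc Ch V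
  | .ctrl => ProbCPS.ctrl warning ID
  | .wait => .tick (.one (ProbCPS.ctrl warning ID))
  | .start => .write actOn .cool (.one (closedLoop warning ID))
  | .loop 0 => closedLoop warning ID
  | .loop (j + 1) => ticks (4 - j) (loopRead warning ID)
  | .finish => .write actOff .cool (.one (.tick (.one (ProbCPS.ctrl warning ID))))

open Classical in
theorem step_ctrl_iff (warning : Ch) (ID : V) (l : Label Ch V EngActuator EngSensor)
    (π : FDist (EngProc Ch V)) :
    (Phase.ctrl.proc warning ID).Step l π ↔ ∃ v, l = .read .st v ∧
      π = dirac ((if 10 < v then Phase.start else Phase.wait).proc warning ID) := by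
  rw [Phase.proc, ctrl, Proc.step_fix_iff, Proc.unfold, ← ctrl, Proc.subst, Proc.step_read_iff]
  refine exists_congr fun v => and_congr_right fun _ => ?_
  rw [Choice.subst_one, Choice.sem_one, subst_ite, cooling]
  simp only [Proc.subst, Choice.subst_one, subst_coolingLoop, if_true, apply_ite (Phase.proc _ _)]
  rfl

/-- The existential hides the recursion body: only the `fix` and its unfolding are ever needed. -/
theorem unfold_closedLoop (warning : Ch) (ID : V) :
    ∃ P, closedLoop warning ID = .fix P ∧ P.unfold = ticks 5 (loopRead warning ID) := by
  refine ⟨_, rfl, ?_⟩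
  rw [Proc.unfold, ← closedLoop, subst_ticks]
  simp [loopRead, warn, Proc.subst, Choice.subst_one, subst_ite, subst_ctrl]

open Classical in
theorem step_loop_five_iff (warning : Ch) (ID : V) (l : Label Ch V EngActuator EngSensor)
    (π : FDist (EngProc Ch V)) :
    ((Phase.loop 5).proc warning ID).Step l π ↔ ∃ v, l = .read .st v ∧
      π = dirac (if 10 < v then warn warning ID else Phase.finish.proc warning ID) := by
  rw [Phase.proc, Nat.sub_self, ticks, loopRead, Proc.step_read_iff]
  simp only [Choice.sem_one]
  rfl

theorem not_step_loop (warning : Ch) (ID : V) {j : ℕ} (hj : j < 5)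
    (l : Label Ch V EngActuator EngSensor) (π : FDist (EngProc Ch V)) :
    ¬ ((Phase.loop j).proc warning ID).Step l π := by
  rcases j with - | j
  · obtain ⟨P, hP, hu⟩ := unfold_closedLoop warning ID
    rw [Phase.proc, hP, Proc.step_fix_iff, hu]
    exact Proc.not_step_tick
  -- Because `j + 1 < 5`, the truncated subtraction leaves at least one tick.
  · obtain ⟨k, hk⟩ : ∃ k, 4 - j = k + 1 := ⟨3 - j, by omega⟩
    rw [Phase.proc, hk]
    exact Proc.not_step_tick

theorem tick_loop_iff (warning : Ch) (ID : V) {j : ℕ} (hj : j < 5) (π : FDist (EngProc Ch V)) :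
    ((Phase.loop j).proc warning ID).Tick π ↔
      π = dirac ((Phase.loop (j + 1)).proc warning ID) := by
  rcases j with - | j
  · obtain ⟨P, hP, hu⟩ := unfold_closedLoop warning ID
    rw [Phase.proc, hP, Proc.tick_fix_iff, hu, ticks, Proc.tick_tick_iff, Choice.sem_one]
    rfl
  · obtain ⟨k, hk⟩ : ∃ k, 4 - j = k + 1 := ⟨3 - j, by omega⟩
    have hk' : 4 - (j + 1) = k := by omega
    rw [Phase.proc, hk, ticks, Proc.tick_tick_iff, Choice.sem_one, Phase.proc, hk']

/-- The physical states in which an engine with cooling power `r` may be in a control state. -/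
def Phase.Inv (r : ℝ) : Phase → EngPState → Prop
  | .ctrl, σ => (0 ≤ σ.x .temp ∧ σ.x .temp ≤ 11.5) ∧ |σ.s .st - σ.x .temp| ≤ 0.1 ∧ 0 ≤ σ.a .cool
  | .wait, σ => (0 ≤ σ.x .temp ∧ σ.x .temp ≤ 10.1) ∧ 0 ≤ σ.a .cool
  | .start, σ => (9.9 ≤ σ.x .temp ∧ σ.x .temp ≤ 11.5) ∧ |σ.s .st - σ.x .temp| ≤ 0.1
  | .loop j, σ => j ≤ 5 ∧ (9.9 - 1.4 * j ≤ σ.x .temp ∧ σ.x .temp ≤ 11.5 - (r - 0.4) * j) ∧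
      |σ.s .st - σ.x .temp| ≤ 0.1 ∧ σ.a .cool < 0
  | .finish, σ => 0 ≤ σ.x .temp ∧ σ.x .temp ≤ 10.1

/-- A bound on the probability that a warning is raised at the end of the current round of the
cooling loop, where `c` bounds the probability that a cooling step lowers the temperature by less
than `0.4`. -/
noncomputable def Phase.risk (c : ℝ) : Phase → EngPState → ℝ
  | .ctrl, σ | .start, σ => if σ.x .temp ≤ 11.4 then 0 else c ^ 5
  | .loop j, σ => if σ.x .temp ≤ 11.4 - 0.3 * j then 0 else c ^ (5 - j)
  | .wait, _ | .finish, _ => 0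

/-- The number of instantaneous actions before time passes. -/
def Phase.rank : Phase → ℕ
  | .ctrl => 2
  | .wait => 0
  | .start => 1
  | .loop j => if j = 5 then 2 else 0
  | .finish => 1

/-- The next action does not lead to a warning. -/
def Phase.Quiet (ph : Phase) (σ : EngPState) : Prop :=
  ph = .loop 5 → σ.s .st ≤ 10

/-- The engine in a given state. -/
noncomputable def engSys (warning : Ch) (ID : V) (r : ℝ) (g : ℕ) (z : Phase × EngPState) :
    CPS Ch V EngVar EngActuator EngSensor :=
  .sys (engEnv r g) z.2 (z.1.proc warning ID)

theorem Phase.risk_nonneg {c : ℝ} (hc : 0 ≤ c) (ph : Phase) (σ : EngPState) :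
    0 ≤ ph.risk c σ := by
  cases ph <;> simp only [Phase.risk, le_refl] <;> split_ifs <;> positivity

theorem Phase.risk_le_one {c : ℝ} (hc : 0 ≤ c) (hc' : c ≤ 1) (ph : Phase) (σ : EngPState) :
    ph.risk c σ ≤ 1 := by
  cases ph <;> simp only [Phase.risk, zero_le_one] <;> split_ifs <;>
    first | exact zero_le_one | exact pow_le_one₀ hc hc'

theorem Phase.Inv.mem_inv {r : ℝ} (hr : 0.7 ≤ r) {g : ℕ} {ph : Phase} {σ : EngPState}
    (h : ph.Inv r σ) : σ.x ∈ (engEnv r g).inv := by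
  change 0 ≤ σ.x .temp ∧ σ.x .temp ≤ 30
  cases ph with
  | loop j =>
    obtain ⟨hj, ⟨h₁, h₂⟩, -⟩ := h
    have hj' : (j : ℝ) ≤ 5 := by exact_mod_cast hj
    -- The extremes are `9.9 - 1.4 * 5 = 2.9` from below and `11.5` from above.
    have hj0 : (0 : ℝ) ≤ j := j.cast_nonneg
    constructor <;> nlinarith
  | ctrl => exact ⟨h.1.1, by linarith [h.1.2]⟩
  | wait => exact ⟨h.1.1, by linarith [h.1.2]⟩
  | start => exact ⟨by linarith [h.1.1], by linarith [h.1.2]⟩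
  | finish => exact ⟨h.1, by linarith [h.2]⟩

/-! ### The passage of time in the engine -/

theorem uniformGrid_congr {v w v' w' : ℝ} (hv : v = v') (hw : w = w') (h : v ≤ w) (h' : v' ≤ w')
    (g : ℕ) : uniformGrid v w h g = uniformGrid v' w' h' g := by
  subst hv hw
  rfl

/-- The least change of temperature in a time slot. -/
noncomputable def minChange (r : ℝ) (σ : EngPState) : ℝ :=
  if 0 ≤ σ.a .cool then 0.6 else -r - 0.4

theorem evol_engEnv (r : ℝ) (g : ℕ) (σ : EngPState) :
    (engEnv r g).evol σ.x σ.a =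
      (uniformGrid (minChange r σ) (minChange r σ + 0.8) (by norm_num) g).map
        fun v _ => σ.x .temp + v := by
  simp only [engEnv, minChange]
  split_ifs
  · congr 1
    exact uniformGrid_congr (by norm_num [delta]) (by norm_num [delta]) _ _ _
  · congr 1
    exact uniformGrid_congr (by norm_num [delta]) (by rw [delta]; ring) _ _ _

theorem forall_next {r : ℝ} {g : ℕ} {σ : EngPState} {p : EngPState → Prop}
    (h : ∀ v s, minChange r σ ≤ v → v ≤ minChange r σ + 0.8 →
      |s - (σ.x .temp + v)| ≤ 0.1 → p ⟨fun _ => σ.x .temp + v, fun _ => s, σ.a⟩) :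
    ((engEnv r g).next σ).Forall p := by
  refine FDist.forall_bind ?_
  rw [evol_engEnv]
  refine FDist.forall_map ((forall_uniformGrid _ g).mono fun v hv => ?_)
  refine FDist.forall_map (FDist.forall_map ((forall_uniformGrid _ g).mono fun w hw => ?_))
  refine h v _ hv.1 hv.2 ?_
  rw [add_sub_cancel_left, abs_le]
  rwa [err] at hw

/-- Risk depends on the true temperature, so the measurement noise averages out and only the tail of
the temperature change contributes. -/
theorem mean_next_le {r : ℝ} {g : ℕ} (hg : 1 ≤ g) {σ : EngPState} {f : EngPState → ℝ} {c : ℝ}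
    (h : ∀ v s, v ≤ minChange r σ + 0.8 → f ⟨fun _ => σ.x .temp + v, s, σ.a⟩ ≤
      c * if v ≤ minChange r σ + 0.7 then 0 else 1) :
    ((engEnv r g).next σ).mean f ≤ c * tailProb g := by
  have hm : minChange r σ ≤ minChange r σ + 0.8 := by norm_num
  rw [← mean_uniformGrid_tail hg hm rfl, ← FDist.mean_mul_left, Env.next, FDist.mean_bind,
    evol_engEnv, FDist.mean_map]
  refine FDist.mean_mono ((forall_uniformGrid _ g).mono fun v hv => ?_)
  rw [FDist.mean_map]
  refine (FDist.mean_mono fun s _ => h v s hv.2).trans_eq (FDist.mean_const _ _)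

/-! ### The transitions of the engine -/

theorem engSys_ctrl (warning : Ch) (ID : V) {r : ℝ} (hr : 0.7 ≤ r) (g : ℕ) {c : ℝ} (hc : 0 ≤ c)
    {σ : EngPState} (h : Phase.ctrl.Inv r σ) :
    ∃ ph : Phase, ph.Inv r σ ∧ ph.Quiet σ ∧ ph.risk c σ ≤ Phase.ctrl.risk c σ ∧ ph.rank < 2 ∧
      (engSys warning ID r g (.ctrl, σ)).OnlyStep .tau
        (dirac (engSys warning ID r g (ph, σ))) := by
  classical
  have ho := CPS.onlyStep_read (s := EngSensor.st) (h.mem_inv hr (g := g))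
    (step_ctrl_iff warning ID)
  obtain ⟨hT, hs, ha⟩ := id h
  rw [abs_le] at hs
  -- The sensor error turns the test at `10` into a temperature of at least `9.9` or at most `10.1`.
  by_cases h10 : 10 < σ.s .st
  · rw [if_pos h10] at ho
    exact ⟨.start, ⟨⟨by linarith [hs.2], hT.2⟩, abs_le.2 hs⟩, nofun, le_rfl, by simp [Phase.rank], ho⟩
  · rw [if_neg h10] at ho
    exact ⟨.wait, ⟨⟨hT.1, by linarith [hs.1]⟩, ha⟩, nofun, Phase.risk_nonneg hc _ _,
      by simp [Phase.rank], ho⟩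

theorem engSys_start (warning : Ch) (ID : V) {r : ℝ} (hr : 0.7 ≤ r) (g : ℕ) {c : ℝ}
    {σ : EngPState} (h : Phase.start.Inv r σ) :
    ∃ σ' : EngPState, (Phase.loop 0).Inv r σ' ∧
      (Phase.loop 0).risk c σ' ≤ Phase.start.risk c σ ∧
      (engSys warning ID r g (.start, σ)).OnlyStep .tau
        (dirac (engSys warning ID r g (.loop 0, σ'))) := by
  refine ⟨σ.setAct .cool actOn, ?_, ?_,
    CPS.onlyStep_write (h.mem_inv hr) fun l π => ?_⟩
  · refine ⟨by norm_num, ?_, h.2, ?_⟩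
    · simpa [PState.setAct] using h.1
    · simp [PState.setAct, actOn]
  · simp [Phase.risk, PState.setAct]
  · rw [Phase.proc, Proc.step_write_iff, Choice.sem_one]
    rfl

theorem engSys_finish (warning : Ch) (ID : V) {r : ℝ} (hr : 0.7 ≤ r) (g : ℕ)
    {σ : EngPState} (h : Phase.finish.Inv r σ) :
    ∃ σ' : EngPState, Phase.wait.Inv r σ' ∧
      (engSys warning ID r g (.finish, σ)).OnlyStep .tau
        (dirac (engSys warning ID r g (.wait, σ'))) := by
  refine ⟨σ.setAct .cool actOff, ⟨h, by simp [PState.setAct, actOff]⟩,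
    CPS.onlyStep_write (h.mem_inv hr) fun l π => ?_⟩
  simp only [Phase.proc, Proc.step_write_iff, Choice.sem_one]

theorem engSys_loop_five (warning : Ch) (ID : V) {r : ℝ} (hr : 0.7 ≤ r) (g : ℕ)
    {σ : EngPState} (h : (Phase.loop 5).Inv r σ) (hq : (Phase.loop 5).Quiet σ) :
    Phase.finish.Inv r σ ∧
      (engSys warning ID r g (.loop 5, σ)).OnlyStep .tau
        (dirac (engSys warning ID r g (.finish, σ))) := by
  classical
  have ho := CPS.onlyStep_read (s := EngSensor.st) (h.mem_inv hr (g := g))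
    (step_loop_five_iff warning ID)
  rw [if_neg (not_lt.2 (hq rfl))] at ho
  obtain ⟨-, ⟨hT, -⟩, hs, -⟩ := h
  rw [abs_le] at hs
  push_cast at hT
  exact ⟨⟨by linarith, by linarith [hs.1, hq rfl]⟩, ho⟩

/-- From at most `10.1`, only a rise above `1.3` leads above `11.4`: this is the factor `q`, and `p
^ 5` is the risk incurred there. -/
theorem engSys_wait (warning : Ch) (ID : V) {r : ℝ} (hr : 0.7 ≤ r) {g : ℕ} (hg : 1 ≤ g)
    {σ : EngPState} (h : Phase.wait.Inv r σ) :
    ((engEnv r g).next σ).Forall (Phase.ctrl.Inv r) ∧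
      ((engEnv r g).next σ).mean (Phase.ctrl.risk (tailProb g)) ≤ tailProb g ^ 5 * tailProb g ∧
      (engSys warning ID r g (.wait, σ)).OnlyStep .tick
        (((engEnv r g).next σ).map fun σ' => engSys warning ID r g (.ctrl, σ')) := by
  have hm : minChange r σ = 0.6 := if_pos h.2
  obtain ⟨⟨hT, hT'⟩, ha⟩ := id h
  refine ⟨forall_next fun v s hv hv' hs => ?_, mean_next_le hg fun v s hv => ?_,
    CPS.onlyStep_tick (h.mem_inv hr) (fun _ _ => Proc.not_step_tick) fun π => ?_⟩
  · rw [hm] at hv hv'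
    exact ⟨⟨by dsimp only; linarith, by dsimp only; linarith⟩, hs, ha⟩
  · rw [hm] at hv ⊢
    have := pow_nonneg (tailProb_nonneg g) 5
    simp only [Phase.risk]
    split_ifs with h₁ h₂ h₂
    · simp
    · simpa using this
    · exact absurd (by linarith) h₁
    · simp
  · rw [Phase.proc, Proc.tick_tick_iff, Choice.sem_one]
    rfl

/-- The threshold falls by `0.3`, the least weak drop, so zero risk persists. Otherwise only the
tail keeps the state above the threshold, and the probability of that tail is the factor by which
the risk per state has grown. -/
theorem engSys_loop (warning : Ch) (ID : V) {r : ℝ} (hr : 0.7 ≤ r) (hr' : r ≤ 1) {g : ℕ}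
    (hg : 1 ≤ g) {σ : EngPState} {j : ℕ} (hj : j < 5) (h : (Phase.loop j).Inv r σ) :
    ((engEnv r g).next σ).Forall ((Phase.loop (j + 1)).Inv r) ∧
      ((engEnv r g).next σ).mean ((Phase.loop (j + 1)).risk (tailProb g)) ≤
        (Phase.loop j).risk (tailProb g) σ ∧
      (engSys warning ID r g (.loop j, σ)).OnlyStep .tick
        (((engEnv r g).next σ).map fun σ' => engSys warning ID r g (.loop (j + 1), σ')) := by
  have hm : minChange r σ = -r - 0.4 := if_neg (not_le.2 h.2.2.2)
  obtain ⟨-, ⟨hT, hT'⟩, -, ha⟩ := id h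
  have hc := tailProb_nonneg g
  refine ⟨forall_next fun v s hv hv' hs => ?_, ?_,
    CPS.onlyStep_tick (h.mem_inv hr) (not_step_loop warning ID hj) (tick_loop_iff warning ID hj)⟩
  · rw [hm] at hv hv'
    refine ⟨hj, ⟨?_, ?_⟩, hs, ha⟩
    · push_cast
      linarith
    · push_cast
      linarith
  · simp only [Phase.risk]
    split_ifs with h₀
    · refine (mean_next_le (c := 0) hg fun v s hv => ?_).trans_eq (zero_mul _)
      rw [hm] at hv
      rw [zero_mul, Phase.risk, if_pos]
      push_cast
      linarith
    · obtain ⟨k, hk⟩ : ∃ k, 5 - j = k + 1 := ⟨4 - j, by omega⟩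
      have hk' : 5 - (j + 1) = k := by omega
      rw [hk, pow_succ]
      refine mean_next_le hg fun v s hv => ?_
      rw [hm, Phase.risk, hk']
      have := pow_nonneg hc k
      -- Compares the envelope slope `r - 0.4` with the threshold slope `0.3`; at `r = 0.7` they
      -- agree.
      have hrj : 0 ≤ (r - 0.7) * j := mul_nonneg (by linarith) j.cast_nonneg
      split_ifs with h₁ h₂ h₂
      · simp
      · simpa using this
      · refine absurd ?_ h₁
        push_cast
        linarith
      · simp

/-- The transitions of the engine from a state in which no warning is imminent. -/
theorem engSys_step (warning : Ch) (ID : V) {r : ℝ} (hr : 0.7 ≤ r) (hr' : r ≤ 1) {g : ℕ}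
    (hg : 1 ≤ g) {z : Phase × EngPState} (hz : z.1.Inv r z.2) (hq : z.1.Quiet z.2) :
    (∃ z' : Phase × EngPState, z'.1.Inv r z'.2 ∧ z'.1.Quiet z'.2 ∧ z'.1.rank < z.1.rank ∧
      z'.1.risk (tailProb g) z'.2 ≤ z.1.risk (tailProb g) z.2 ∧
      (engSys warning ID r g z).OnlyStep .tau (dirac (engSys warning ID r g z'))) ∨
    ∃ ν : FDist (Phase × EngPState), (ν.Forall fun z' => z'.1.Inv r z'.2) ∧
      (1 - z.1.risk (tailProb g) z.2) * (1 - tailProb g * tailProb g ^ 5) ≤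
        1 - ν.mean (fun z' => z'.1.risk (tailProb g) z'.2) ∧
      (engSys warning ID r g z).OnlyStep .tick (ν.map (engSys warning ID r g)) := by
  have hc := tailProb_nonneg g
  obtain ⟨ph, σ⟩ := z
  cases ph with
  | ctrl =>
    obtain ⟨ph, h₁, h₂, h₃, h₄, h₅⟩ := engSys_ctrl warning ID hr g hc hz
    exact .inl ⟨(ph, σ), h₁, h₂, h₄, h₃, h₅⟩
  | start =>
    obtain ⟨σ', h₁, h₂, h₃⟩ := engSys_start warning ID hr g hz
    exact .inl ⟨(.loop 0, σ'), h₁, nofun, by simp [Phase.rank], h₂, h₃⟩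
  | finish =>
    obtain ⟨σ', h₁, h₂⟩ := engSys_finish warning ID hr g hz
    exact .inl ⟨(.wait, σ'), h₁, nofun, by simp [Phase.rank], le_rfl, h₂⟩
  | wait =>
    obtain ⟨h₁, h₂, h₃⟩ := engSys_wait warning ID hr hg hz
    refine .inr ⟨((engEnv r g).next σ).map fun σ' => (.ctrl, σ'), FDist.forall_map h₁, ?_, ?_⟩
    · rw [FDist.mean_map]
      refine le_trans ?_ (sub_le_sub_left h₂ 1)
      rw [Phase.risk, sub_zero, one_mul, mul_comm (tailProb g)]
    · rwa [StdSimplex.map_map]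
  | loop j =>
    rcases hz.1.eq_or_lt with rfl | hj
    · obtain ⟨h₁, h₂⟩ := engSys_loop_five warning ID hr g hz hq
      exact .inl ⟨(.finish, σ), h₁, nofun, by simp [Phase.rank], Phase.risk_nonneg hc _ _, h₂⟩
    · obtain ⟨h₁, h₂, h₃⟩ := engSys_loop warning ID hr hr' hg hj hz
      refine .inr ⟨((engEnv r g).next σ).map fun σ' => (.loop (j + 1), σ'),
        FDist.forall_map h₁, ?_, ?_⟩
      · rw [FDist.mean_map]
        have h₄ := Phase.risk_le_one hc (tailProb_le_one g) (.loop j) σ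
        have h₅ : 0 ≤ tailProb g * tailProb g ^ 5 := by positivity
        -- Inside the loop the mean risk does not grow, so the extra factor on the left is pure
        -- slack.
        have h₆ := mul_nonneg (sub_nonneg.2 h₄) h₅
        dsimp only
        linarith
      · rwa [StdSimplex.map_map]

/-- An engine in which no warning is imminent can let time pass. -/
theorem engSys_weakStep (warning : Ch) (ID : V) {r : ℝ} (hr : 0.7 ≤ r) (hr' : r ≤ 1) {g : ℕ}
    (hg : 1 ≤ g) {z : Phase × EngPState} (hz : z.1.Inv r z.2) (hq : z.1.Quiet z.2) :
    ∃ ν : FDist (Phase × EngPState), (ν.Forall fun z' => z'.1.Inv r z'.2) ∧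
      (1 - z.1.risk (tailProb g) z.2) * (1 - tailProb g * tailProb g ^ 5) ≤
        1 - ν.mean (fun z' => z'.1.risk (tailProb g) z'.2) ∧
      (engSys warning ID r g z).WeakStep .tick
        (StdSimplex.map (engSys warning ID r g) ν).weights := by
  -- Instantaneous actions lower the rank, so a tick is reached; they do not raise the risk, so the
  -- estimate carries back.
  induction hk : z.1.rank using Nat.strong_induction_on generalizing z with
  | _ k ih =>
    have hc := tailProb_nonneg g
    rcases engSys_step warning ID hr hr' hg hz hq with ⟨z', h₁, h₂, h₃, h₄, h₅⟩ | ⟨ν, h₁, h₂, h₃⟩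
    · obtain ⟨ν, hν, hm, hw⟩ := ih _ (hk ▸ h₃) h₁ h₂ rfl
      refine ⟨ν, hν, le_trans ?_ hm, h₅.step.weakStep_cons hw⟩
      have : tailProb g * tailProb g ^ 5 ≤ 1 :=
        mul_le_one₀ (tailProb_le_one g) (by positivity) (pow_le_one₀ hc (tailProb_le_one g))
      exact mul_le_mul_of_nonneg_right (by linarith) (by linarith)
    · exact ⟨ν, h₁, h₂, h₃.step.weakStep⟩

/-- With full cooling power no warning is ever imminent. -/
theorem Phase.Inv.quiet {ph : Phase} {σ : EngPState} (h : ph.Inv 1 σ) : ph.Quiet σ := by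
  rintro rfl
  obtain ⟨-, ⟨-, hT⟩, hs, -⟩ := h
  rw [abs_le] at hs
  push_cast at hT
  -- After five full-power slots the temperature is at most `11.5 - 0.6 * 5 = 8.5`.
  linarith [hs.2]

/-- A warning is imminent only if the risk is `1`. -/
theorem Phase.Inv.quiet_of_risk {r : ℝ} {ph : Phase} {σ : EngPState} (h : ph.Inv r σ) {c : ℝ}
    (hc : ph.risk c σ ≠ 1) : ph.Quiet σ := by
  rintro rfl
  by_contra hs
  obtain ⟨-, -, hs', -⟩ := h
  rw [abs_le] at hs'
  refine hc ?_
  -- A reading above `10` forces a temperature above `9.9 = 11.4 - 0.3 * 5`, where the risk is `c ^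
  -- 0`.
  rw [Phase.risk, if_neg, Nat.sub_self, pow_zero]
  push_cast
  linarith [hs'.2]

/-- The bound is affine in the risk, so its expectation is governed by the expected risk. It equals
`1` at risk `1`, so states about to warn, and everything after a warning, need no analysis. -/
theorem nDist_engSys_le (warning : Ch) (ID : V) {g : ℕ} (hg : 1 ≤ g) (n : ℕ)
    {z z' : Phase × EngPState} (hz : z.1.Inv 1 z.2) (hz' : z'.1.Inv 0.7 z'.2) :
    (nDist n (engSys warning ID 1 g z) (engSys warning ID 0.7 g z') : ℝ) ≤
      1 - (1 - z'.1.risk (tailProb g) z'.2) * (1 - tailProb g * tailProb g ^ 5) ^ n := by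
  have hc := tailProb_nonneg g
  have hc' := tailProb_le_one g
  set b := 1 - tailProb g * tailProb g ^ 5 with hb
  have hb0 : 0 ≤ b := sub_nonneg.2 (mul_le_one₀ hc' (by positivity) (pow_le_one₀ hc hc'))
  have hb1 : b ≤ 1 := sub_le_self _ (by positivity)
  have hw (z : Phase × EngPState) : 0 ≤ 1 - z.1.risk (tailProb g) z.2 :=
    sub_nonneg.2 (Phase.risk_le_one hc hc' _ _)
  have hw' (z : Phase × EngPState) : 1 - z.1.risk (tailProb g) z.2 ≤ 1 :=
    sub_le_self _ (Phase.risk_nonneg hc _ _)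
  have hmono (n : ℕ) : b ^ (n + 1) ≤ b ^ n := pow_le_pow_of_le_one hb0 hb1 n.le_succ
  -- One tick uses up one factor `b`, matching the step from `n` to `n + 1`.
  have hmean {n : ℕ} {z : Phase × EngPState} {ν : FDist (Phase × EngPState)}
      (h : (1 - z.1.risk (tailProb g) z.2) * b ≤
        1 - ν.mean fun z' => z'.1.risk (tailProb g) z'.2) :
      (ν.mean fun z' => 1 - (1 - z'.1.risk (tailProb g) z'.2) * b ^ n) ≤
        1 - (1 - z.1.risk (tailProb g) z.2) * b ^ (n + 1) := by
    have hcomm : (fun z' : Phase × EngPState => 1 - (1 - z'.1.risk (tailProb g) z'.2) * b ^ n) =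
        fun z' => 1 - b ^ n * (1 - z'.1.risk (tailProb g) z'.2) :=
      funext fun _ => by rw [mul_comm]
    rw [hcomm, FDist.mean_one_sub, FDist.mean_mul_left, FDist.mean_one_sub]
    have := mul_le_mul_of_nonneg_left h (pow_nonneg hb0 n)
    rw [pow_succ]
    linarith
  refine nDist_le (e := engSys warning ID 1 g) (e' := engSys warning ID 0.7 g)
    (p := fun z => z.1.Inv 1 z.2) (p' := fun z => z.1.Inv 0.7 z.2)
    (f := fun n z => 1 - (1 - z.1.risk (tailProb g) z.2) * b ^ n)
    (fun n z => sub_nonneg.2 (mul_le_one₀ (hw' z) (pow_nonneg hb0 n) (pow_le_one₀ hb0 hb1)))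
    (fun z hz => ⟨?_, ?_⟩) (fun n z hz hlt => ?_) n z z' hz hz'
  · rcases engSys_step warning ID (by norm_num) le_rfl hg hz hz.quiet with
      ⟨z', h₁, -, -, -, h₂⟩ | ⟨ν, h₁, -, h₂⟩
    · exact .inl ⟨z', h₁, h₂⟩
    · exact .inr ⟨ν, h₁, h₂⟩
  · obtain ⟨ν, h₁, -, h₂⟩ := engSys_weakStep warning ID (by norm_num) le_rfl hg hz hz.quiet
    exact ⟨ν, h₁, h₂⟩
  · have hq : z.1.Quiet z.2 := by
      refine hz.quiet_of_risk (c := tailProb g) fun h => ?_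
      rw [h, sub_self, zero_mul, sub_zero] at hlt
      exact lt_irrefl _ hlt
    refine ⟨sub_le_sub_left (mul_le_mul_of_nonneg_left (hmono n) (hw z)) _, ?_, ?_⟩
    · rcases engSys_step warning ID le_rfl (by norm_num) hg hz hq with
        ⟨z', h₁, -, -, h₂, h₃⟩ | ⟨ν, h₁, h₂, h₃⟩
      · exact .inl ⟨z', h₁, sub_le_sub_left (mul_le_mul (sub_le_sub_left h₂ _) (hmono n)
          (pow_nonneg hb0 _) (hw z')) _, h₃⟩
      · exact .inr ⟨ν, h₁, hmean h₂, h₃⟩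
    · obtain ⟨ν, h₁, h₂, h₃⟩ := engSys_weakStep warning ID le_rfl (by norm_num) hg hz hq
      exact ⟨ν, h₁, hmean h₂, h₃⟩

end Engine

end ProbCPS

theorem mainTheorem6 (Ch V : Type) (warning : Ch) (ID : V) (g : ℕ) (hg : 1 ≤ g) (n : ℕ) :
    ((ProbCPS.nDist n (ProbCPS.Eng warning ID g) (ProbCPS.EngHat warning ID g) : ℝ)
      ≤ 1 - (1 - ProbCPS.qRatio g * ProbCPS.pRatio g ^ 5) ^ n) ∧
    ProbCPS.pRatio g = 1 / (8 + (10 : ℝ) ^ (1 - (g : ℤ))) ∧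
    ProbCPS.qRatio g = 1 / (8 + (10 : ℝ) ^ (1 - (g : ℤ))) := by
  refine ⟨?_, ProbCPS.pRatio_eq_tailProb hg, ProbCPS.qRatio_eq_tailProb hg⟩
  have hinv (r : ℝ) : ProbCPS.Phase.ctrl.Inv r ProbCPS.engState := by
    simp only [ProbCPS.Phase.Inv, ProbCPS.engState, ProbCPS.actOff]
    norm_num
  have h := ProbCPS.nDist_engSys_le warning ID hg n (z := (.ctrl, ProbCPS.engState))
    (z' := (.ctrl, ProbCPS.engState)) (hinv 1) (hinv 0.7)
  -- The initial temperature `0` is below `11.4`.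
  have hrisk : ProbCPS.Phase.ctrl.risk (ProbCPS.tailProb g) ProbCPS.engState = 0 :=
    if_pos (by norm_num [ProbCPS.engState])
  rw [hrisk, sub_zero, one_mul] at h
  rw [ProbCPS.pRatio_eq_tailProb hg, ProbCPS.qRatio_eq_tailProb hg]
  exact h
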